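/- Let $1<\alpha\le 2$ and let $u:\mathbb R\to\mathbb C$ belong to $\mathscr C^{4+\alpha}(\mathbb R)$, i.e. $u\in L^1(\mathbb R)$, $\int_{\mathbb R}(1+|\xi|)^{4+\alpha}|\hat u(\xi)|\,d\xi<\infty$ with $\hat u(\xi)=\int_{\mathbb R}u(x)e^{-i\xi x}\,dx$, and $u$ is the continuous representative of its class. **Derivatives.** Let $$D^{\alpha}_{-\infty,x}u(x)=\frac{1}{\Gamma(2-\alpha)}\frac{d^2}{dx^2}\int_{-\infty}^{x}\frac{u(y)\,dy}{(x-y)^{\alpha-1}},\qquad D^{\alpha}_{x,+\infty}u(x)=\frac{1}{\Gamma(2-\alpha)}\frac{d^2}{dx^2}\int_{x}^{\infty}\frac{u(y)\,dy}{(y-x)^{\alpha-1}}$$ for $\alpha<2$, and let both be $u''$ for $\alpha=2$. Let $c_\alpha=-\frac{1}{2\cos(\pi\alpha/2)}$, let $\partial_x^\alpha u=c_\alpha\,(D^{\alpha}_{-\infty,x}u+D^{\alpha}_{x,+\infty}u)$ be the Riesz derivative, and let $$(-\Delta)^{\alpha/2}u(x)=K_\alpha\,\mathrm{p.v.}\!\int_{\mathbb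 R}\frac{u(x)-u(y)}{|x-y|^{1+\alpha}}\,dy,\qquad K_\alpha=\frac{2^\alpha\,\Gamma(\frac{1+\alpha}2)}{\pi^{1/2}\,|\Gamma(-\frac\alpha2)|}\qquad(\alpha<2),$$ and $(-\Delta)^{1}u=-u''$ for $\alpha=2$. **Difference operators.** Let $P(z)=\frac{3\alpha-2}{2\alpha}-\frac{2(\alpha-1)}{\alpha}z+\frac{\alpha-2}{2\alpha}z^2$, $\eta=\frac{(3\alpha-2)(\alpha-2)(\alpha-1)}{24\alpha}$ and $G_4(z)=[1+\eta P(z)^2]\,P(z)^\alpha$ (principal branch), let $\kappa_{4,m}^{(\alpha)}$ be the coefficient of $z^m$ in the power series of $G_4$ at $0$, and let $\varrho_2^{(\alpha)}$ be the coefficient of $z^2$ in the power series of $\frac{e^z}{z^\alpha}G_4(e^{-z})$ at $0$. For $h>0$ put $${}^L\mathcal B_h^\alpha u(x)=\frac1{h^\alpha}\sum_{m=0}^\infty\kappa_{4,m}^{(\alpha)}u(x-(m-1)h),\qquad {}^R\mathcal B_h^\alpha u(x)=\frac1{h^\alpha}\sum_{m=0}^\infty\kappa_{4,m}^{(\alpha)}u(x+(m-1)h),$$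 and $\delta_x^2f(x)=[f(x-h)-2f(x)+f(x+h)]/h^2$. **Claim.** The coefficient is $\varrho_2^{(\alpha)}=\frac{3\alpha^3-19\alpha^2+36\alpha-16}{24\alpha}$. All derivatives, principal values and series above exist at every $x\in\mathbb R$. Uniformly for $x\in\mathbb R$, as $h\to0^+$, $$[1+\varrho_2^{(\alpha)}h^2\delta_x^2]\,D^\alpha_{-\infty,x}u(x)={}^L\mathcal B_h^\alpha u(x)+O(h^4),$$ $$[1+\varrho_2^{(\alpha)}h^2\delta_x^2]\,D^\alpha_{x,+\infty}u(x)={}^R\mathcal B_h^\alpha u(x)+O(h^4),$$ $$[1+\varrho_2^{(\alpha)}h^2\delta_x^2]\,\partial_x^\alpha u(x)=c_\alpha({}^L\mathcal B_h^\alpha+{}^R\mathcal B_h^\alpha)u(x)+O(h^4),$$ $$[1+\varrho_2^{(\alpha)}h^2\delta_x^2]\,(-\Delta)^{\alpha/2}u(x)=-c_\alpha({}^L\mathcal B_h^\alpha+{}^R\mathcal B_h^\alpha)u(x)+O(h^4).$$ If moreover $u$ vanishes outside $(a,b)$ for some real numbers $a<b$, then, uniformly for $a<x<b$, as $h\to0^+$,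 $$[1+\varrho_2^{(\alpha)}h^2\delta_x^2]\,(-\Delta)^{\alpha/2}u(x)=-c_\alpha({}^L\mathcal A_h^\alpha+{}^R\mathcal A_h^\alpha)u(x)+O(h^4),$$ where ${}^L\mathcal A_h^\alpha$ and ${}^R\mathcal A_h^\alpha$ are obtained from ${}^L\mathcal B_h^\alpha$ and ${}^R\mathcal B_h^\alpha$ by stopping the sums at $m=\lfloor (x-a)/h\rfloor$ and $m=\lfloor (b-x)/h\rfloor$, respectively. The constants in the $O(h^4)$ terms may depend on $\alpha$, $u$, $a$ and $b$. -/

import Mathlib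

open MeasureTheory Filter Topology
open scoped Nat

noncomputable section

namespace FracCompact

/-! ### The function class -/

/-- The Fourier transform `∫ u(x) e^{-iξx} dx`. -/
def fourierHat (u : ℝ → ℂ) (ξ : ℝ) : ℂ :=
  ∫ x : ℝ, u x * Complex.exp (-Complex.I * (ξ : ℂ) * (x : ℂ))

/-- `u ∈ L¹(ℝ)` with `∫ (1 + |ξ|)^s |û(ξ)| dξ < ∞`. Elements of `L¹` are classes of functions; since
`û` is integrable such a class has exactly one continuous representative, and `u` is that one. -/
structure MemC (s : ℝ) (u : ℝ → ℂ) : Prop where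
  integrable : Integrable u
  continuous : Continuous u
  integrable_hat : Integrable (fun ξ : ℝ => (1 + |ξ|) ^ s * ‖fourierHat u ξ‖)

/-! ### Riemann–Liouville and Riesz derivatives, fractional Laplacian -/

/-- Left Riemann–Liouville integral of order `β ≥ 0` on `(-∞, x]`; order `0` is the identity. -/
def rlIntegralLeft (β : ℝ) (u : ℝ → ℂ) (x : ℝ) : ℂ :=
  if β = 0 then u x
  else ((1 / Real.Gamma β : ℝ) : ℂ) *
    ∫ y in Set.Iio x, u y / (((x - y) ^ (1 - β) : ℝ) : ℂ)

/-- Right Riemann–Liouville integral of order `β ≥ 0` on `[x, ∞)`; order `0` is the identity. -/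
def rlIntegralRight (β : ℝ) (u : ℝ → ℂ) (x : ℝ) : ℂ :=
  if β = 0 then u x
  else ((1 / Real.Gamma β : ℝ) : ℂ) *
    ∫ y in Set.Ioi x, u y / (((y - x) ^ (1 - β) : ℝ) : ℂ)

/-- Left Riemann–Liouville derivative of order `α ∈ (1, 2]`. -/
def rlDerivLeft (α : ℝ) (u : ℝ → ℂ) : ℝ → ℂ :=
  iteratedDeriv 2 (rlIntegralLeft (2 - α) u)

/-- Right Riemann–Liouville derivative of order `α ∈ (1, 2]`. -/
def rlDerivRight (α : ℝ) (u : ℝ → ℂ) : ℝ → ℂ :=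
  iteratedDeriv 2 (rlIntegralRight (2 - α) u)

/-- The left derivative of order `α` is meaningful at every point: the defining integrals converge
absolutely and define a twice differentiable function. -/
def RLLeftExists (α : ℝ) (u : ℝ → ℂ) : Prop :=
  (α < 2 → ∀ x : ℝ,
    IntegrableOn (fun y : ℝ => u y / (((x - y) ^ (α - 1) : ℝ) : ℂ)) (Set.Iio x)) ∧
  Differentiable ℝ (rlIntegralLeft (2 - α) u) ∧
  Differentiable ℝ (deriv (rlIntegralLeft (2 - α) u))

/-- The right derivative of order `α` is meaningful at every point. -/
def RLRightExists (α : ℝ) (u : ℝ → ℂ) : Prop :=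
  (α < 2 → ∀ x : ℝ,
    IntegrableOn (fun y : ℝ => u y / (((y - x) ^ (α - 1) : ℝ) : ℂ)) (Set.Ioi x)) ∧
  Differentiable ℝ (rlIntegralRight (2 - α) u) ∧
  Differentiable ℝ (deriv (rlIntegralRight (2 - α) u))

/-- The factor `-1 / (2 cos(πα/2))`. -/
def rieszConst (α : ℝ) : ℝ := -(1 / (2 * Real.cos (Real.pi * α / 2)))

/-- The Riesz derivative of order `α`. -/
def rieszDeriv (α : ℝ) (u : ℝ → ℂ) (x : ℝ) : ℂ :=
  (rieszConst α : ℂ) * (rlDerivLeft α u x + rlDerivRight α u x)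

/-- `K_α = 2^α Γ((1+α)/2) / (π^{1/2} |Γ(-α/2)|)`. -/
def lapConst (α : ℝ) : ℝ :=
  2 ^ α * Real.Gamma ((1 + α) / 2) / (Real.sqrt Real.pi * |Real.Gamma (-(α / 2))|)

/-- The integrand `(u(x) - u(y)) / |x - y|^{1+α}`. -/
def lapKernel (α : ℝ) (u : ℝ → ℂ) (x y : ℝ) : ℂ :=
  (u x - u y) / ((|x - y| ^ (1 + α) : ℝ) : ℂ)

/-- The hypersingular integral, truncated to `|x - y| > ε`. -/
def lapTrunc (α : ℝ) (u : ℝ → ℂ) (x ε : ℝ) : ℂ :=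
  ∫ y in {y : ℝ | ε < |x - y|}, lapKernel α u x y

/-- The fractional Laplacian `(-Δ)^{α/2} u(x) = K_α p.v. ∫ (u(x) - u(y)) / |x - y|^{1+α} dy` for
`1 < α < 2` (for these `α` the integral converges only as a principal value), and `-u''` for
`α = 2`. -/
def fracLaplacian (α : ℝ) (u : ℝ → ℂ) (x : ℝ) : ℂ :=
  if α = 2 then -iteratedDeriv 2 u x
  else (lapConst α : ℂ) * limUnder (𝓝[>] (0 : ℝ)) (lapTrunc α u x)

/-- The fractional Laplacian is meaningful at every point: for `α < 2` the truncated integrals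
converge absolutely and have a limit, for `α = 2` the function is twice differentiable. -/
def FracLaplacianExists (α : ℝ) (u : ℝ → ℂ) : Prop :=
  (α < 2 → ∀ x : ℝ,
    (∀ ε : ℝ, 0 < ε → IntegrableOn (lapKernel α u x) {y : ℝ | ε < |x - y|}) ∧
    ∃ L : ℂ, Tendsto (lapTrunc α u x) (𝓝[>] (0 : ℝ)) (𝓝 L)) ∧
  (α = 2 → Differentiable ℝ u ∧ Differentiable ℝ (deriv u))

/-! ### Generating function and difference operators -/

/-- `b₀ + b₁ z + b₂ z²` with `b₀ = (3α-2)/(2α)`, `b₁ = -2(α-1)/α`, `b₂ = (α-2)/(2α)`. -/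
def genBase (α : ℝ) (z : ℂ) : ℂ :=
  (((3 * α - 2) / (2 * α) : ℝ) : ℂ) + ((-(2 * (α - 1) / α) : ℝ) : ℂ) * z +
    (((α - 2) / (2 * α) : ℝ) : ℂ) * z ^ 2

/-- `η = (3α-2)(α-2)(α-1) / (24α)`. -/
def eta (α : ℝ) : ℝ := (3 * α - 2) * (α - 2) * (α - 1) / (24 * α)

/-- `G₂(z) = (b₀ + b₁ z + b₂ z²)^α`, principal branch. -/
def G₂ (α : ℝ) (z : ℂ) : ℂ := genBase α z ^ (α : ℂ)

/-- `G₄(z) = [1 + η (b₀ + b₁ z + b₂ z²)²] G₂(z)`. -/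
def G₄ (α : ℝ) (z : ℂ) : ℂ := (1 + (eta α : ℂ) * genBase α z ^ 2) * G₂ α z

/-- The coefficient of `z^m` in the power series of `G₄` at `0`. -/
def kappa₄ (α : ℝ) (m : ℕ) : ℂ := iteratedDeriv m (G₄ α) 0 / (m ! : ℂ)

/-- `z ↦ e^z z^{-α} G₄(e^{-z})` with its removable singularity at `0` filled by the value `1`. -/
def symbolFun (α : ℝ) : ℂ → ℂ :=
  Function.update (fun z : ℂ => Complex.exp z / z ^ (α : ℂ) * G₄ α (Complex.exp (-z))) 0 1

/-- The coefficient of `z^m` in the power series of `e^z z^{-α} G₄(e^{-z})` at `0`. -/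
def varrho (α : ℝ) (m : ℕ) : ℂ := iteratedDeriv m (symbolFun α) 0 / (m ! : ℂ)

/-- `h^{-α} ∑_{m ≥ 0} κ_{4,m} u(x - (m-1)h)`. -/
def BL (α h : ℝ) (u : ℝ → ℂ) (x : ℝ) : ℂ :=
  1 / ((h ^ α : ℝ) : ℂ) * ∑' m : ℕ, kappa₄ α m * u (x - ((m : ℝ) - 1) * h)

/-- `h^{-α} ∑_{m ≥ 0} κ_{4,m} u(x + (m-1)h)`. -/
def BR (α h : ℝ) (u : ℝ → ℂ) (x : ℝ) : ℂ :=
  1 / ((h ^ α : ℝ) : ℂ) * ∑' m : ℕ, kappa₄ α m * u (x + ((m : ℝ) - 1) * h)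

/-- `h^{-α} ∑_{m = 0}^{⌊(x-a)/h⌋} κ_{4,m} u(x - (m-1)h)`. -/
def AL (a α h : ℝ) (u : ℝ → ℂ) (x : ℝ) : ℂ :=
  1 / ((h ^ α : ℝ) : ℂ) *
    ∑ m ∈ Finset.range (⌊(x - a) / h⌋₊ + 1), kappa₄ α m * u (x - ((m : ℝ) - 1) * h)

/-- `h^{-α} ∑_{m = 0}^{⌊(b-x)/h⌋} κ_{4,m} u(x + (m-1)h)`. -/
def AR (b α h : ℝ) (u : ℝ → ℂ) (x : ℝ) : ℂ :=
  1 / ((h ^ α : ℝ) : ℂ) *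
    ∑ m ∈ Finset.range (⌊(b - x) / h⌋₊ + 1), kappa₄ α m * u (x + ((m : ℝ) - 1) * h)

/-- Second-order central difference. -/
def centralDiff (h : ℝ) (f : ℝ → ℂ) (x : ℝ) : ℂ :=
  (f (x - h) - 2 * f x + f (x + h)) / (h : ℂ) ^ 2

/-- The compact operator `1 + ϱ₂ h² δ_x²`. -/
def compactOp (α h : ℝ) (f : ℝ → ℂ) (x : ℝ) : ℂ :=
  f x + varrho α 2 * (h : ℂ) ^ 2 * centralDiff h f x

/-- `E h x = O(h^4)` as `h → 0⁺`, uniformly for `x ∈ S`. -/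
def UniformO4 (S : Set ℝ) (E : ℝ → ℝ → ℂ) : Prop :=
  ∃ C : ℝ, ∀ᶠ h in 𝓝[>] (0 : ℝ), ∀ x ∈ S, ‖E h x‖ ≤ C * h ^ 4

end FracCompact

end

/-!
The proof is Fourier analytic. Since `∫ (1 + |ξ|)^{4+α} |û| < ∞`, the function `u` is the
superposition `synth (density u)` of plane waves, and every operator in the theorem acts on it as
multiplication of the spectral density by a symbol:

* `rlDerivLeft α` by `(iξ)^α` (`MemC.rlDerivLeft_eq`). The Riemann–Liouville integral of order
  `2 - α` is damped by `e^{-εt}`, so that Fubini and the Laplace transform of a power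
  (`laplace_rpow`) apply, and `ε → 0`; then one differentiates twice under the integral.
* `fracLaplacian α` by `|ξ|^α` (`MemC.fracLaplacian_eq`). The truncated hypersingular integrals have
  multipliers dominated by a constant times `|ξ|^α`. The constant is identified
  (`lapConst_mul_cosMoment`) by testing with the Gaussian `e^{-x²}` at the origin. Because
  `(iξ)^α + (-iξ)^α = 2 cos(πα/2) |ξ|^α`, this operator is minus the Riesz derivative.
* `BL α h` by `h^{-α} e^{iξh} G₄(e^{-iξh})` (`MemC.BL_eq_synth`). Here `G₄(z) = (1 - z)^α H(z)` with
  `H` holomorphic beyond the closed unit disc, and `(1 - z)^α` has absolutely summable Taylor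
  coefficients, so the Taylor series of `G₄` converges absolutely on the unit circle.

With `P(e^{-z}) = z g(z)` the function `e^z z^{-α} G₄(e^{-z})` equals `e^z g(z)^α (1 + η z² g(z)²)`
near `0`, and a computation with third-order jets gives `1 + ϱ₂ z² + O(z⁴)`
(`hasJet_regularSymbol`). Hence the symbol of the error is at most `C h⁴ |ξ|^{4+α}` for all `ξ` and
`h` (`exists_norm_errorSymbol_le`), which is integrable against the density. The right-sided
formulas follow by the reflection `x ↦ -x`, the others by linear combination.

For `u` supported in an interval, each truncated sum omits one possibly nonzero term, a value of `u`
within distance `h` of the end point. That value equals a sixth backward difference of `u`, hence is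
`O(h^{4+α})` by the same spectral estimate (`MemC.exists_boundary_bound`), and the factor `h^{-α}`
leaves `O(h⁴)`.
-/

noncomputable section

namespace FracCompact

/-! ### Superpositions of plane waves -/

/-- The superposition `∫ w(ξ) e^{iξx} dξ` of plane waves with spectral density `w`. -/
def synth (w : ℝ → ℂ) (x : ℝ) : ℂ :=
  ∫ ξ : ℝ, w ξ * Complex.exp (Complex.I * (ξ : ℂ) * (x : ℂ))

/-- The spectral density `û / 2π`, normalised so that `u = synth (density u)`. -/
def density (u : ℝ → ℂ) (ξ : ℝ) : ℂ := fourierHat u ξ / (2 * Real.pi)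

lemma norm_exp_I_mul (ξ x : ℝ) : ‖Complex.exp (Complex.I * (ξ : ℂ) * (x : ℂ))‖ = 1 := by
  have : Complex.I * (ξ : ℂ) * (x : ℂ) = ((ξ * x : ℝ) : ℂ) * Complex.I := by push_cast; ring
  rw [this, Complex.norm_exp_ofReal_mul_I]

lemma integrable_mul_exp {w : ℝ → ℂ} (hw : Integrable w) (x : ℝ) :
    Integrable (fun ξ : ℝ => w ξ * Complex.exp (Complex.I * (ξ : ℂ) * (x : ℂ))) := by
  refine hw.mul_bdd (c := 1) ?_ ?_
  · exact Continuous.aestronglyMeasurable (by fun_prop)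
  · exact Eventually.of_forall fun ξ => (norm_exp_I_mul ξ x).le

lemma norm_synth_le (w : ℝ → ℂ) (x : ℝ) : ‖synth w x‖ ≤ ∫ ξ, ‖w ξ‖ := by
  refine (norm_integral_le_integral_norm _).trans_eq ?_
  simp [norm_exp_I_mul]

lemma synth_add {w₁ w₂ : ℝ → ℂ} (h₁ : Integrable w₁) (h₂ : Integrable w₂) (x : ℝ) :
    synth (fun ξ => w₁ ξ + w₂ ξ) x = synth w₁ x + synth w₂ x := by
  unfold synth
  rw [← integral_add (integrable_mul_exp h₁ x) (integrable_mul_exp h₂ x)]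
  simp only [add_mul]

lemma synth_sub {w₁ w₂ : ℝ → ℂ} (h₁ : Integrable w₁) (h₂ : Integrable w₂) (x : ℝ) :
    synth (fun ξ => w₁ ξ - w₂ ξ) x = synth w₁ x - synth w₂ x := by
  unfold synth
  rw [← integral_sub (integrable_mul_exp h₁ x) (integrable_mul_exp h₂ x)]
  simp only [sub_mul]

lemma synth_const_mul (c : ℂ) (w : ℝ → ℂ) (x : ℝ) :
    synth (fun ξ => c * w ξ) x = c * synth w x := by
  unfold synth
  rw [← integral_const_mul]
  simp only [mul_assoc]

/-- Translating a superposition multiplies its density by a phase. -/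
lemma synth_translate (w : ℝ → ℂ) (x y : ℝ) :
    synth w (x + y) =
      synth (fun ξ => w ξ * Complex.exp (Complex.I * (ξ : ℂ) * (y : ℂ))) x := by
  unfold synth
  congr 1; ext ξ
  rw [mul_assoc (w ξ), ← Complex.exp_add]
  push_cast; ring_nf

lemma synth_comp_neg (w : ℝ → ℂ) (x : ℝ) : synth (fun ξ => w (-ξ)) x = synth w (-x) := by
  unfold synth
  rw [← integral_neg_eq_self]
  congr 1; ext ξ
  simp

/-- Differentiation under the integral sign. -/
lemma hasDerivAt_synth {w : ℝ → ℂ} (hw : Integrable w)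
    (hw' : Integrable (fun ξ : ℝ => Complex.I * (ξ : ℂ) * w ξ)) (x : ℝ) :
    HasDerivAt (synth w) (synth (fun ξ => Complex.I * (ξ : ℂ) * w ξ) x) x := by
  refine (hasDerivAt_integral_of_dominated_loc_of_deriv_le
    (F := fun (x : ℝ) (ξ : ℝ) => w ξ * Complex.exp (Complex.I * (ξ : ℂ) * (x : ℂ)))
    (F' := fun (x : ℝ) (ξ : ℝ) =>
      Complex.I * (ξ : ℂ) * w ξ * Complex.exp (Complex.I * (ξ : ℂ) * (x : ℂ)))
    (bound := fun ξ : ℝ => ‖Complex.I * (ξ : ℂ) * w ξ‖) (s := Set.univ) univ_mem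
    ?_ ?_ ?_ ?_ hw'.norm ?_).2
  · exact Eventually.of_forall fun x => (integrable_mul_exp hw x).aestronglyMeasurable
  · exact integrable_mul_exp hw x
  · exact (integrable_mul_exp hw' x).aestronglyMeasurable
  · refine Eventually.of_forall fun ξ y _ => ?_
    rw [norm_mul, norm_exp_I_mul, mul_one]
  · refine Eventually.of_forall fun ξ y _ => ?_
    have h1 : HasDerivAt (fun y : ℝ => Complex.I * (ξ : ℂ) * (y : ℂ)) (Complex.I * (ξ : ℂ)) y := by
      simpa using (Complex.ofRealCLM.hasDerivAt (x := y)).const_mul (Complex.I * (ξ : ℂ))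
    have h2 := (h1.cexp).const_mul (w ξ)
    exact h2.congr_deriv (by ring)

/-! ### Fourier inversion and the weighted spectral density -/

lemma fourierHat_eq (u : ℝ → ℂ) (ξ : ℝ) :
    fourierHat u ξ = FourierTransform.fourier u (ξ / (2 * Real.pi)) := by
  rw [Real.fourier_real_eq_integral_exp_smul, fourierHat]
  congr 1; ext x
  rw [smul_eq_mul, mul_comm]
  congr 2
  push_cast
  field_simp

lemma continuous_density {u : ℝ → ℂ} (hu : Integrable u) : Continuous (density u) := by
  have h : Continuous (FourierTransform.fourier u : ℝ → ℂ) :=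
    VectorFourier.fourierIntegral_continuous Real.continuous_fourierChar
      (by exact continuous_inner) hu
  unfold density
  simp only [fourierHat_eq]
  fun_prop

lemma norm_density_le (u : ℝ → ℂ) (ξ : ℝ) : ‖density u ξ‖ ≤ ∫ x, ‖u x‖ := by
  have h1 : ‖fourierHat u ξ‖ ≤ ∫ x, ‖u x‖ := by
    refine (norm_integral_le_integral_norm _).trans_eq ?_
    congr 1; ext x
    have : -Complex.I * (ξ : ℂ) * (x : ℂ) = Complex.I * ((-ξ : ℝ) : ℂ) * (x : ℂ) := by
      push_cast; ring
    rw [norm_mul, this, norm_exp_I_mul, mul_one]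
  have h2 : ‖(2 * Real.pi : ℂ)‖ = 2 * Real.pi := by
    have : (2 * Real.pi : ℂ) = ((2 * Real.pi : ℝ) : ℂ) := by push_cast; rfl
    rw [this, Complex.norm_real, Real.norm_of_nonneg (by positivity)]
  rw [density, norm_div, h2]
  refine (div_le_self (norm_nonneg _) ?_).trans h1
  linarith [Real.pi_gt_three]

lemma integrableOn_abs_rpow_Icc {r : ℝ} (hr : -1 < r) :
    IntegrableOn (fun ξ : ℝ => |ξ| ^ r) (Set.Icc (-1) 1) := by
  have h1 : IntegrableOn (fun ξ : ℝ => |ξ| ^ r) (Set.Ioc 0 1) := by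
    refine (((intervalIntegrable_iff_integrableOn_Ioc_of_le zero_le_one).1
      (intervalIntegral.intervalIntegrable_rpow' (a := 0) (b := 1) hr))).congr_fun ?_
      measurableSet_Ioc
    intro x hx
    simp only [abs_of_pos hx.1]
  have h2 : IntegrableOn (fun ξ : ℝ => |ξ| ^ r) (Set.Ico (-1) 0) := by
    have := h1.comp_neg
    simpa using this
  have h3 : IntegrableOn (fun ξ : ℝ => |ξ| ^ r) {0} := by simp
  have := (h2.union h3).union h1
  refine this.mono_set ?_
  intro x hx
  rcases lt_trichotomy x 0 with h | h | h
  · exact Or.inl (Or.inl ⟨hx.1, h⟩)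
  · exact Or.inl (Or.inr h)
  · exact Or.inr ⟨h, hx.2⟩

/-- All moments of order between `-1` (excluded) and `s` of the spectral density are finite: near
zero frequency the density is bounded, away from it the weight in `MemC` dominates. -/
lemma MemC.integrable_rpow_mul_density {s : ℝ} (hs : 0 ≤ s) {u : ℝ → ℂ} (hu : MemC s u)
    {r : ℝ} (hr : -1 < r) (hrs : r ≤ s) : Integrable (fun ξ : ℝ => |ξ| ^ r * ‖density u ξ‖) := by
  have hb : Integrable ((Set.Icc (-1 : ℝ) 1).indicator
      (fun ξ : ℝ => |ξ| ^ r * ∫ x, ‖u x‖)) := by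
    rw [integrable_indicator_iff measurableSet_Icc]
    refine Integrable.mul_const ?_ _
    exact integrableOn_abs_rpow_Icc hr
  refine (hb.add hu.integrable_hat).mono' ?_ ?_
  · refine (Measurable.mul (by fun_prop) ?_).aestronglyMeasurable
    exact (continuous_density hu.integrable).measurable.norm
  · refine Eventually.of_forall fun ξ => ?_
    have h0 : 0 ≤ |ξ| ^ r := Real.rpow_nonneg (abs_nonneg _) _
    have h1 : 0 ≤ (1 + |ξ|) ^ s := Real.rpow_nonneg (by positivity) _
    rw [Real.norm_of_nonneg (mul_nonneg h0 (norm_nonneg _)), Pi.add_apply]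
    by_cases hξ : ξ ∈ Set.Icc (-1 : ℝ) 1
    · rw [Set.indicator_of_mem hξ]
      have := mul_le_mul_of_nonneg_left (norm_density_le u ξ) h0
      have h2 := mul_nonneg h1 (norm_nonneg (fourierHat u ξ))
      linarith
    · rw [Set.indicator_of_notMem hξ, zero_add]
      have h2 : 1 ≤ |ξ| := by
        rw [Set.mem_Icc, ← abs_le] at hξ
        exact (not_le.1 hξ).le
      refine mul_le_mul ?_ ?_ (norm_nonneg _) h1
      · exact (Real.rpow_le_rpow_of_exponent_le h2 hrs).trans
          (Real.rpow_le_rpow (abs_nonneg _) (by linarith) hs)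
      · rw [density, norm_div]
        refine div_le_self (norm_nonneg _) ?_
        have h2 : ‖(2 * Real.pi : ℂ)‖ = 2 * Real.pi := by
          have : (2 * Real.pi : ℂ) = ((2 * Real.pi : ℝ) : ℂ) := by push_cast; rfl
          rw [this, Complex.norm_real, Real.norm_of_nonneg (by positivity)]
        rw [h2]; linarith [Real.pi_gt_three]

lemma MemC.integrable_density {s : ℝ} (hs : 0 ≤ s) {u : ℝ → ℂ} (hu : MemC s u) :
    Integrable (density u) := by
  have h := hu.integrable_rpow_mul_density hs (r := 0) (by norm_num) hs
  simp only [Real.rpow_zero, one_mul] at h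
  exact (integrable_norm_iff (continuous_density hu.integrable).aestronglyMeasurable).1 h

/-- Fourier inversion in the normalisation of `fourierHat`. -/
lemma MemC.synth_density {s : ℝ} (hs : 0 ≤ s) {u : ℝ → ℂ} (hu : MemC s u) (x : ℝ) :
    synth (density u) x = u x := by
  have hπ : (2 * Real.pi : ℝ) ≠ 0 := by positivity
  have hF : Integrable (FourierTransform.fourier u : ℝ → ℂ) := by
    have h1 := ((hu.integrable_density hs).const_mul (2 * Real.pi : ℂ)).comp_mul_left' hπ
    refine h1.congr (Eventually.of_forall fun ξ => ?_)
    have : (2 * Real.pi : ℂ) ≠ 0 := by exact_mod_cast hπ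
    simp only [density, fourierHat_eq]
    rw [mul_div_cancel₀ _ this, mul_div_cancel_left₀ _ hπ]
  rw [← hu.integrable.fourierInv_fourier_eq hF hu.continuous.continuousAt, Real.fourierInv_eq']
  have h2 := Measure.integral_comp_div (fun v : ℝ =>
    Complex.exp (((2 * Real.pi * inner ℝ v x : ℝ) : ℂ) * Complex.I) • (FourierTransform.fourier u : ℝ → ℂ) v) (2 * Real.pi)
  rw [abs_of_pos (by positivity), ← inv_smul_eq_iff₀ hπ, ← integral_smul] at h2
  rw [← h2, synth]
  congr 1; ext ξ
  rw [density, fourierHat_eq, Complex.real_smul, smul_eq_mul]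
  have h3 : Complex.I * (ξ : ℂ) * (x : ℂ) =
      ((2 * Real.pi * inner ℝ (ξ / (2 * Real.pi)) x : ℝ) : ℂ) * Complex.I := by
    simp only [RCLike.inner_apply, conj_trivial]
    push_cast
    field_simp
  rw [h3]
  push_cast
  ring

lemma MemC.exists_bound {s : ℝ} (hs : 0 ≤ s) {u : ℝ → ℂ} (hu : MemC s u) :
    ∃ B : ℝ, 0 ≤ B ∧ ∀ x, ‖u x‖ ≤ B :=
  ⟨∫ ξ, ‖density u ξ‖, integral_nonneg fun _ => norm_nonneg _, fun x => by
    rw [← hu.synth_density hs x]; exact norm_synth_le _ x⟩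

lemma fourierHat_comp_neg (u : ℝ → ℂ) (ξ : ℝ) :
    fourierHat (fun x => u (-x)) ξ = fourierHat u (-ξ) := by
  unfold fourierHat
  rw [← integral_neg_eq_self]
  congr 1; ext x
  simp

lemma density_comp_neg (u : ℝ → ℂ) (ξ : ℝ) :
    density (fun x => u (-x)) ξ = density u (-ξ) := by
  rw [density, density, fourierHat_comp_neg]

/-- The function class is invariant under reflection; this reduces everything about right-sided
operators to left-sided ones. -/
lemma MemC.comp_neg {s : ℝ} {u : ℝ → ℂ} (hu : MemC s u) : MemC s (fun x => u (-x)) where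
  integrable := hu.integrable.comp_neg
  continuous := hu.continuous.comp continuous_neg
  integrable_hat := by
    have := hu.integrable_hat.comp_neg
    simpa [fourierHat_comp_neg] using this

/-! ### Power multipliers -/

lemma ofReal_mul_cpow {r : ℝ} (hr : 0 < r) (z a : ℂ) :
    ((r : ℂ) * z) ^ a = (r : ℂ) ^ a * z ^ a := by
  have hr' : (r : ℂ) ≠ 0 := by exact_mod_cast hr.ne'
  rcases eq_or_ne z 0 with rfl | hz
  · rcases eq_or_ne a 0 with rfl | ha
    · simp
    · simp [Complex.zero_cpow ha]
  · rw [Complex.cpow_def_of_ne_zero (mul_ne_zero hr' hz), Complex.cpow_def_of_ne_zero hr',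
      Complex.cpow_def_of_ne_zero hz, Complex.log_ofReal_mul hr hz, ← Complex.exp_add,
      Complex.ofReal_log hr.le]
    ring_nf

lemma norm_I_mul_cpow (r ξ : ℝ) : ‖(Complex.I * (ξ : ℂ)) ^ (r : ℂ)‖ = |ξ| ^ r := by
  rw [Complex.norm_cpow_real, norm_mul, Complex.norm_I, one_mul, Complex.norm_real,
    Real.norm_eq_abs]

lemma MemC.integrable_cpow_mul_density {s : ℝ} (hs : 0 ≤ s) {u : ℝ → ℂ} (hu : MemC s u) {r : ℝ}
    (hr : -1 < r) (hrs : r ≤ s) :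
    Integrable (fun ξ : ℝ => (Complex.I * (ξ : ℂ)) ^ (r : ℂ) * density u ξ) := by
  refine (hu.integrable_rpow_mul_density hs hr hrs).mono' ?_ ?_
  · refine (Measurable.mul ?_ (continuous_density hu.integrable).measurable).aestronglyMeasurable
    exact Measurable.pow_const (by fun_prop) _
  · refine Eventually.of_forall fun ξ => ?_
    rw [norm_mul, norm_I_mul_cpow]

lemma I_mul_mul_cpow {r : ℝ} (hr : r + 1 ≠ 0) (ξ : ℝ) :
    Complex.I * (ξ : ℂ) * (Complex.I * (ξ : ℂ)) ^ (r : ℂ) =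
      (Complex.I * (ξ : ℂ)) ^ ((r + 1 : ℝ) : ℂ) := by
  by_cases h : Complex.I * (ξ : ℂ) = 0
  · rw [h, zero_mul, Complex.zero_cpow (by exact_mod_cast hr)]
  · push_cast
    rw [Complex.cpow_add _ _ h, Complex.cpow_one, mul_comm]

/-- Differentiation raises the order of a power multiplier by one. -/
lemma MemC.hasDerivAt_synth_cpow {s : ℝ} (hs : 0 ≤ s) {u : ℝ → ℂ} (hu : MemC s u) {r : ℝ}
    (hr : -1 < r) (hrs : r + 1 ≤ s) (x : ℝ) :
    HasDerivAt (synth fun ξ => (Complex.I * (ξ : ℂ)) ^ (r : ℂ) * density u ξ)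
      (synth (fun ξ => (Complex.I * (ξ : ℂ)) ^ ((r + 1 : ℝ) : ℂ) * density u ξ) x) x := by
  have h := hasDerivAt_synth (w := fun ξ => (Complex.I * (ξ : ℂ)) ^ (r : ℂ) * density u ξ)
    (hu.integrable_cpow_mul_density hs hr (by linarith)) ?_ x
  · simpa only [← mul_assoc, I_mul_mul_cpow (show r + 1 ≠ 0 by linarith)] using h
  · simpa only [← mul_assoc, I_mul_mul_cpow (show r + 1 ≠ 0 by linarith)] using
      hu.integrable_cpow_mul_density hs (r := r + 1) (by linarith) hrs

/-! ### The Laplace transform of a power -/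

lemma integrableOn_rpow_mul_exp {s b : ℝ} (hs : -1 < s) (hb : 0 < b) :
    IntegrableOn (fun t : ℝ => t ^ s * Real.exp (-b * t)) (Set.Ioi 0) := by
  simpa using integrableOn_rpow_mul_exp_neg_mul_rpow hs (p := 1) one_pos hb

lemma norm_rpow_mul_exp {t : ℝ} (ht : 0 < t) (s : ℝ) (r : ℂ) :
    ‖((t ^ s : ℝ) : ℂ) * Complex.exp (-(r * t))‖ = t ^ s * Real.exp (-r.re * t) := by
  rw [norm_mul, Complex.norm_real, Real.norm_of_nonneg (Real.rpow_nonneg ht.le _),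
    Complex.norm_exp]
  simp

lemma integrableOn_rpow_mul_cexp {s : ℝ} (hs : -1 < s) {r : ℂ} (hr : 0 < r.re) :
    IntegrableOn (fun t : ℝ => ((t ^ s : ℝ) : ℂ) * Complex.exp (-(r * t))) (Set.Ioi 0) := by
  refine (integrableOn_rpow_mul_exp hs hr).mono' ?_ ?_
  · exact (Measurable.mul (by fun_prop) (by fun_prop)).aestronglyMeasurable
  · refine (ae_restrict_iff' measurableSet_Ioi).2 (Eventually.of_forall fun t ht => ?_)
    rw [norm_rpow_mul_exp ht]

lemma differentiableAt_laplace_rpow {s : ℝ} (hs : -1 < s) {r : ℂ} (hr : 0 < r.re) :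
    DifferentiableAt ℂ (fun r : ℂ => ∫ t in Set.Ioi (0 : ℝ),
      ((t ^ s : ℝ) : ℂ) * Complex.exp (-(r * t))) r := by
  have hopen : {z : ℂ | r.re / 2 < z.re} ∈ 𝓝 r :=
    (isOpen_lt continuous_const Complex.continuous_re).mem_nhds (by simp; linarith)
  refine (hasDerivAt_integral_of_dominated_loc_of_deriv_le
    (F' := fun (r : ℂ) (t : ℝ) => ((t ^ s : ℝ) : ℂ) * (Complex.exp (-(r * t)) * (-t)))
    (bound := fun t : ℝ => t ^ (s + 1) * Real.exp (-(r.re / 2) * t)) hopen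
    ?_ ?_ ?_ ?_ ?_ ?_).2.differentiableAt
  · exact Eventually.of_forall fun z =>
      (Measurable.mul (by fun_prop) (by fun_prop)).aestronglyMeasurable
  · exact integrableOn_rpow_mul_cexp hs hr
  · exact (Measurable.mul (by fun_prop) (by fun_prop)).aestronglyMeasurable
  · refine (ae_restrict_iff' measurableSet_Ioi).2 (Eventually.of_forall fun t ht z hz => ?_)
    have ht' : (0 : ℝ) < t := ht
    rw [← mul_assoc, norm_mul, norm_rpow_mul_exp ht', norm_neg, Complex.norm_real,
      Real.norm_of_nonneg ht'.le, mul_right_comm, ← Real.rpow_add_one ht'.ne']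
    refine mul_le_mul_of_nonneg_left (Real.exp_le_exp.2 ?_) (Real.rpow_nonneg ht'.le _)
    have : r.re / 2 < z.re := hz
    nlinarith
  · exact integrableOn_rpow_mul_exp (by linarith) (by linarith)
  · refine Eventually.of_forall fun t z _ => ?_
    refine HasDerivAt.const_mul _ (HasDerivAt.cexp ?_)
    simpa using ((hasDerivAt_id z).mul_const (t : ℂ)).fun_neg

/-- `∫₀^∞ t^{β-1} e^{-rt} dt = r^{-β} Γ(β)` for complex `r` in the right half-plane, by analytic
continuation from real `r`. -/
lemma laplace_rpow {β : ℝ} (hβ : 0 < β) {r : ℂ} (hr : 0 < r.re) :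
    ∫ t in Set.Ioi (0 : ℝ), ((t ^ (β - 1) : ℝ) : ℂ) * Complex.exp (-(r * t)) =
      r ^ ((-β : ℝ) : ℂ) * (Real.Gamma β : ℂ) := by
  set F : ℂ → ℂ := fun r => ∫ t in Set.Ioi (0 : ℝ),
    ((t ^ (β - 1) : ℝ) : ℂ) * Complex.exp (-(r * t)) with hF
  set G : ℂ → ℂ := fun r => r ^ ((-β : ℝ) : ℂ) * (Real.Gamma β : ℂ) with hG
  set U : Set ℂ := {z | 0 < z.re} with hU
  have hUo : IsOpen U := isOpen_lt continuous_const Complex.continuous_re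
  have hUc : IsPreconnected U := (convex_halfSpace_re_gt 0).isPreconnected
  have hFa : AnalyticOnNhd ℂ F U := DifferentiableOn.analyticOnNhd
    (fun z hz => (differentiableAt_laplace_rpow (by linarith) hz).differentiableWithinAt) hUo
  have hGa : AnalyticOnNhd ℂ G U := by
    refine DifferentiableOn.analyticOnNhd (fun z hz => ?_) hUo
    refine DifferentiableAt.differentiableWithinAt ?_
    exact (differentiableAt_id.cpow_const (Or.inl hz)).mul_const _
  have hreal : ∀ x : ℝ, 0 < x → F x = G x := by
    intro x hx
    simp only [hF, hG]
    have h1 := Real.integral_rpow_mul_exp_neg_mul_Ioi hβ hx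
    have h2 : (x : ℂ) ^ ((-β : ℝ) : ℂ) = (((1 / x) ^ β : ℝ) : ℂ) := by
      rw [← Complex.ofReal_cpow hx.le, one_div, Real.rpow_neg hx.le, Real.inv_rpow hx.le]
    rw [h2, ← Complex.ofReal_mul, ← h1]
    refine Eq.trans ?_ integral_complex_ofReal
    congr 1; ext t
    push_cast; ring
  have hfreq : ∃ᶠ z in 𝓝[≠] (1 : ℂ), F z = G z := by
    have ht : Tendsto (fun x : ℝ => (x : ℂ)) (𝓝[≠] (1 : ℝ)) (𝓝[≠] (1 : ℂ)) := by
      refine tendsto_nhdsWithin_iff.2 ⟨?_, ?_⟩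
      · exact (Complex.continuous_ofReal.tendsto' 1 1 (by simp)).mono_left nhdsWithin_le_nhds
      · filter_upwards [self_mem_nhdsWithin] with x hx
        simpa using hx
    refine ht.frequently (Eventually.frequently ?_)
    filter_upwards [nhdsWithin_le_nhds (lt_mem_nhds (zero_lt_one' ℝ))] with x hx using hreal x hx
  exact hFa.eqOn_of_preconnected_of_frequently_eq hGa hUc (by simp [hU]) hfreq hr

/-! ### Riemann–Liouville operators as Fourier multipliers -/

lemma MemC.integrableOn_rl {s : ℝ} (hs : 0 ≤ s) {u : ℝ → ℂ} (hu : MemC s u) {β : ℝ} (hβ : 0 < β)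
    (hβ' : β < 1) (x : ℝ) :
    IntegrableOn (fun t : ℝ => u (x - t) * ((t ^ (β - 1) : ℝ) : ℂ)) (Set.Ioi 0) := by
  obtain ⟨B, hB, hub⟩ := hu.exists_bound hs
  have h1 : Integrable ((Set.Ioc (0 : ℝ) 1).indicator (fun t : ℝ => B * t ^ (β - 1))) := by
    rw [integrable_indicator_iff measurableSet_Ioc]
    refine Integrable.const_mul ?_ _
    exact (intervalIntegrable_iff_integrableOn_Ioc_of_le zero_le_one).1
        (intervalIntegral.intervalIntegrable_rpow' (by linarith))
  have h2 : Integrable (fun t => ‖u (x - t)‖) := (hu.integrable.comp_sub_left x).norm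
  refine (h1.add h2).integrableOn.mono' ?_ ?_
  · refine (Measurable.mul ?_ (by fun_prop)).aestronglyMeasurable
    exact hu.continuous.measurable.comp (by fun_prop)
  · refine (ae_restrict_iff' measurableSet_Ioi).2 (Eventually.of_forall fun t ht => ?_)
    have ht' : (0 : ℝ) < t := ht
    have h0 : 0 ≤ t ^ (β - 1) := Real.rpow_nonneg ht'.le _
    rw [norm_mul, Complex.norm_real, Real.norm_of_nonneg h0, Pi.add_apply]
    by_cases h : t ≤ 1
    · rw [Set.indicator_of_mem (show t ∈ Set.Ioc (0 : ℝ) 1 from ⟨ht', h⟩)]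
      have := mul_le_mul_of_nonneg_right (hub (x - t)) h0
      linarith [norm_nonneg (u (x - t))]
    · rw [Set.indicator_of_notMem (fun h' => h h'.2), zero_add]
      refine mul_le_of_le_one_right (norm_nonneg _) ?_
      exact Real.rpow_le_one_of_one_le_of_nonpos (not_le.1 h).le (by linarith)

/-- Exponential damping makes the Riemann–Liouville integral absolutely convergent in both
variables, so that Fubini applies. -/
lemma MemC.damped_rl {s : ℝ} (hs : 0 ≤ s) {u : ℝ → ℂ} (hu : MemC s u) {β : ℝ} (hβ : 0 < β)
    (x : ℝ) {ε : ℝ} (hε : 0 < ε) :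
    ∫ t in Set.Ioi (0 : ℝ), u (x - t) * ((t ^ (β - 1) : ℝ) : ℂ) * (Real.exp (-ε * t) : ℂ) =
      ∫ ξ : ℝ, ((ε : ℂ) + Complex.I * ξ) ^ ((-β : ℝ) : ℂ) * (Real.Gamma β : ℂ) * density u ξ *
        Complex.exp (Complex.I * (ξ : ℂ) * (x : ℂ)) := by
  have hv := hu.integrable_density hs
  have hprod : Integrable (Function.uncurry fun (t ξ : ℝ) =>
      (((t ^ (β - 1) : ℝ) : ℂ) * Complex.exp (-(((ε : ℂ) + Complex.I * ξ) * t))) *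
        (density u ξ * Complex.exp (Complex.I * (ξ : ℂ) * (x : ℂ))))
      ((volume.restrict (Set.Ioi (0 : ℝ))).prod volume) := by
    have h1 := (integrableOn_rpow_mul_cexp (s := β - 1) (by linarith)
      (r := (ε : ℂ)) (by simpa using hε))
    have h2 := Integrable.mul_prod h1 (integrable_mul_exp hv x)
    have h3 := h2.mul_bdd (c := 1)
      (g := fun z : ℝ × ℝ => Complex.exp (Complex.I * ((-z.2 : ℝ) : ℂ) * (z.1 : ℂ)))
      (Continuous.aestronglyMeasurable (by fun_prop))
      (Eventually.of_forall fun z => (norm_exp_I_mul _ _).le)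
    refine h3.congr (Eventually.of_forall fun z => ?_)
    have : -(((ε : ℂ) + Complex.I * z.2) * z.1) =
      -((ε : ℂ) * z.1) + Complex.I * ((-z.2 : ℝ) : ℂ) * (z.1 : ℂ) := by push_cast; ring
    simp only [Function.uncurry]
    rw [this, Complex.exp_add]
    ring
  have hswap := integral_integral_swap hprod
  have hL : ∀ t : ℝ, u (x - t) * ((t ^ (β - 1) : ℝ) : ℂ) * (Real.exp (-ε * t) : ℂ) =
      ∫ ξ : ℝ, (((t ^ (β - 1) : ℝ) : ℂ) * Complex.exp (-(((ε : ℂ) + Complex.I * ξ) * t))) *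
        (density u ξ * Complex.exp (Complex.I * (ξ : ℂ) * (x : ℂ))) := by
    intro t
    rw [← hu.synth_density hs (x - t), synth, mul_assoc, mul_comm, ← integral_const_mul]
    congr 1; ext ξ
    have : Complex.I * (ξ : ℂ) * ((x - t : ℝ) : ℂ) =
      Complex.I * (ξ : ℂ) * (x : ℂ) + -(Complex.I * ξ * t) := by push_cast; ring
    have h' : -(((ε : ℂ) + Complex.I * ξ) * t) = ((-ε * t : ℝ) : ℂ) + -(Complex.I * ξ * t) := by
      push_cast; ring
    rw [this, h', Complex.exp_add, Complex.exp_add, Complex.ofReal_exp]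
    ring
  simp only [hL]
  rw [hswap]
  congr 1; ext ξ
  rw [integral_mul_const, laplace_rpow hβ (by simpa using hε)]
  ring

lemma MemC.integral_rl {s : ℝ} (hs : 0 ≤ s) {u : ℝ → ℂ} (hu : MemC s u) {β : ℝ} (hβ : 0 < β)
    (hβ' : β < 1) (x : ℝ) :
    ∫ t in Set.Ioi (0 : ℝ), u (x - t) * ((t ^ (β - 1) : ℝ) : ℂ) =
      (Real.Gamma β : ℂ) *
        synth (fun ξ => (Complex.I * (ξ : ℂ)) ^ ((-β : ℝ) : ℂ) * density u ξ) x := by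
  have hT1 : Tendsto (fun ε : ℝ => ∫ t in Set.Ioi (0 : ℝ),
      u (x - t) * ((t ^ (β - 1) : ℝ) : ℂ) * (Real.exp (-ε * t) : ℂ)) (𝓝[>] 0)
      (𝓝 (∫ t in Set.Ioi (0 : ℝ), u (x - t) * ((t ^ (β - 1) : ℝ) : ℂ))) := by
    refine tendsto_integral_filter_of_dominated_convergence
      (fun t => ‖u (x - t) * ((t ^ (β - 1) : ℝ) : ℂ)‖) ?_ ?_
      (hu.integrableOn_rl hs hβ hβ' x).norm ?_
    · refine Eventually.of_forall fun ε => AEStronglyMeasurable.mul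
        (hu.integrableOn_rl hs hβ hβ' x).aestronglyMeasurable ?_
      exact Continuous.aestronglyMeasurable (by fun_prop)
    · filter_upwards [self_mem_nhdsWithin] with ε hε
      refine (ae_restrict_iff' measurableSet_Ioi).2 (Eventually.of_forall fun t ht => ?_)
      rw [norm_mul _ (Complex.ofReal _)]
      refine mul_le_of_le_one_right (norm_nonneg _) ?_
      rw [Complex.norm_real, Real.norm_of_nonneg (Real.exp_pos _).le, Real.exp_le_one_iff]
      have := mul_pos (Set.mem_Ioi.1 hε) (Set.mem_Ioi.1 ht)
      linarith
    · refine Eventually.of_forall fun t => ?_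
      have : Continuous (fun ε : ℝ => u (x - t) * ((t ^ (β - 1) : ℝ) : ℂ) *
        (Real.exp (-ε * t) : ℂ)) := by fun_prop
      exact (this.tendsto' 0 _ (by simp)).mono_left nhdsWithin_le_nhds
  have hT2 : Tendsto (fun ε : ℝ => ∫ ξ : ℝ, ((ε : ℂ) + Complex.I * ξ) ^ ((-β : ℝ) : ℂ) *
      (Real.Gamma β : ℂ) * density u ξ * Complex.exp (Complex.I * (ξ : ℂ) * (x : ℂ))) (𝓝[>] 0)
      (𝓝 (∫ ξ : ℝ, (Complex.I * (ξ : ℂ)) ^ ((-β : ℝ) : ℂ) *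
      (Real.Gamma β : ℂ) * density u ξ * Complex.exp (Complex.I * (ξ : ℂ) * (x : ℂ)))) := by
    refine tendsto_integral_filter_of_dominated_convergence
      (fun ξ => |Real.Gamma β| * (|ξ| ^ (-β) * ‖density u ξ‖)) ?_ ?_
      ((hu.integrable_rpow_mul_density hs (by linarith) (by linarith)).const_mul _) ?_
    · refine Eventually.of_forall fun ε => Measurable.aestronglyMeasurable ?_
      refine Measurable.mul (Measurable.mul (Measurable.mul ?_ measurable_const)
        (continuous_density hu.integrable).measurable) (by fun_prop)
      exact Measurable.pow_const (by fun_prop) _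
    · filter_upwards [self_mem_nhdsWithin] with ε hε
      have h0 : ∀ᵐ ξ : ℝ, ξ ≠ 0 := by simp [ae_iff]
      filter_upwards [h0] with ξ hξ
      rw [norm_mul, norm_exp_I_mul, mul_one, norm_mul, norm_mul, Complex.norm_cpow_real,
        Complex.norm_real, Real.norm_eq_abs, mul_comm (_ ^ _), mul_assoc]
      refine mul_le_mul_of_nonneg_left (mul_le_mul_of_nonneg_right ?_ (norm_nonneg _))
        (abs_nonneg _)
      refine Real.rpow_le_rpow_of_nonpos (abs_pos.2 hξ) ?_ (by linarith)
      have := Complex.abs_im_le_norm ((ε : ℂ) + Complex.I * ξ)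
      simpa using this
    · have h0 : ∀ᵐ ξ : ℝ, ξ ≠ 0 := by simp [ae_iff]
      filter_upwards [h0] with ξ hξ
      have hc : ContinuousAt (fun ε : ℝ => ((ε : ℂ) + Complex.I * ξ) ^ ((-β : ℝ) : ℂ)) 0 := by
        refine ContinuousAt.cpow (by fun_prop) continuousAt_const ?_
        right; simpa using hξ
      have hc' : Tendsto (fun ε : ℝ => ((ε : ℂ) + Complex.I * ξ) ^ ((-β : ℝ) : ℂ)) (𝓝[>] 0)
          (𝓝 ((Complex.I * ξ) ^ ((-β : ℝ) : ℂ))) := by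
        have := hc.tendsto.mono_left (nhdsWithin_le_nhds (s := Set.Ioi 0))
        simpa using this
      exact ((hc'.mul_const _).mul_const _).mul_const _
  have heq : (fun ε : ℝ => ∫ t in Set.Ioi (0 : ℝ),
      u (x - t) * ((t ^ (β - 1) : ℝ) : ℂ) * (Real.exp (-ε * t) : ℂ)) =ᶠ[𝓝[>] 0]
      fun ε : ℝ => ∫ ξ : ℝ, ((ε : ℂ) + Complex.I * ξ) ^ ((-β : ℝ) : ℂ) *
      (Real.Gamma β : ℂ) * density u ξ * Complex.exp (Complex.I * (ξ : ℂ) * (x : ℂ)) := by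
    filter_upwards [self_mem_nhdsWithin] with ε hε using hu.damped_rl hs hβ x hε
  rw [tendsto_nhds_unique (hT1.congr' heq) hT2, synth, ← integral_const_mul]
  congr 1; ext ξ; ring

/-- The substitution `y = x - t` on a half-line. -/
lemma sub_left_measurePreserving_measurableEmbedding (x : ℝ) :
    MeasurePreserving (fun t : ℝ => x - t) ∧ MeasurableEmbedding (fun t : ℝ => x - t) :=
  ⟨Measure.measurePreserving_sub_left volume x, (MeasurableEquiv.subLeft x).measurableEmbedding⟩

lemma rl_integrand_comp (u : ℝ → ℂ) (γ x t : ℝ) (ht : 0 < t) :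
    u (x - t) / (((x - (x - t)) ^ γ : ℝ) : ℂ) = u (x - t) * ((t ^ (-γ) : ℝ) : ℂ) := by
  rw [sub_sub_cancel, Real.rpow_neg ht.le, div_eq_mul_inv]
  push_cast; rfl

/-- In the spectral picture the left Riemann–Liouville integral of order `2 - α` is the multiplier
`(iξ)^{α-2}`, whose singularity at `ξ = 0` is integrable because `α > 1`. -/
lemma MemC.rlIntegralLeft_eq {s : ℝ} (hs : 0 ≤ s) {u : ℝ → ℂ} (hu : MemC s u) {α : ℝ}
    (hα : 1 < α) (hα' : α ≤ 2) :
    rlIntegralLeft (2 - α) u =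
      synth (fun ξ => (Complex.I * (ξ : ℂ)) ^ ((α - 2 : ℝ) : ℂ) * density u ξ) := by
  ext x
  unfold rlIntegralLeft
  split_ifs with h
  · have : α - 2 = 0 := by linarith
    simp [this, hu.synth_density hs]
  · have hβ : 0 < 2 - α := lt_of_le_of_ne (by linarith) (Ne.symm h)
    have hsub : ∫ y in Set.Iio x, u y / (((x - y) ^ (1 - (2 - α)) : ℝ) : ℂ) =
        ∫ t in Set.Ioi (0 : ℝ), u (x - t) * ((t ^ ((2 - α) - 1) : ℝ) : ℂ) := by
      rw [← (sub_left_measurePreserving_measurableEmbedding x).1.setIntegral_preimage_emb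
        (sub_left_measurePreserving_measurableEmbedding x).2]
      have : (fun t : ℝ => x - t) ⁻¹' Set.Iio x = Set.Ioi 0 := by ext t; simp
      rw [this]
      refine setIntegral_congr_fun measurableSet_Ioi fun t ht => ?_
      rw [rl_integrand_comp u _ x t ht]
      ring_nf
    rw [hsub, hu.integral_rl hs hβ (by linarith), ← mul_assoc, ← Complex.ofReal_mul,
      one_div_mul_cancel (Real.Gamma_pos_of_pos hβ).ne', Complex.ofReal_one, one_mul]
    congr 1; ext ξ; ring_nf

lemma MemC.hasDerivAt_rlIntegralLeft {s : ℝ} {u : ℝ → ℂ} (hu : MemC s u) {α : ℝ}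
    (hα : 1 < α) (hα' : α ≤ 2) (hαs : α ≤ s) (x : ℝ) :
    HasDerivAt (rlIntegralLeft (2 - α) u)
      (synth (fun ξ => (Complex.I * (ξ : ℂ)) ^ ((α - 1 : ℝ) : ℂ) * density u ξ) x) x := by
  rw [hu.rlIntegralLeft_eq (by linarith) hα hα']
  have := hu.hasDerivAt_synth_cpow (by linarith) (r := α - 2) (by linarith) (by linarith) x
  rwa [show α - 2 + 1 = α - 1 by ring] at this

lemma MemC.hasDerivAt_deriv_rlIntegralLeft {s : ℝ} {u : ℝ → ℂ} (hu : MemC s u) {α : ℝ}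
    (hα : 1 < α) (hα' : α ≤ 2) (hαs : α ≤ s) (x : ℝ) :
    HasDerivAt (deriv (rlIntegralLeft (2 - α) u))
      (synth (fun ξ => (Complex.I * (ξ : ℂ)) ^ (α : ℂ) * density u ξ) x) x := by
  rw [show deriv (rlIntegralLeft (2 - α) u) = _ from
    funext fun x => (hu.hasDerivAt_rlIntegralLeft hα hα' hαs x).deriv]
  have := hu.hasDerivAt_synth_cpow (by linarith) (r := α - 1) (by linarith) (by linarith) x
  rwa [show α - 1 + 1 = α by ring] at this

/-- The left Riemann–Liouville derivative is the multiplier `(iξ)^α`. -/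
lemma MemC.rlDerivLeft_eq {s : ℝ} {u : ℝ → ℂ} (hu : MemC s u) {α : ℝ}
    (hα : 1 < α) (hα' : α ≤ 2) (hαs : α ≤ s) :
    rlDerivLeft α u = synth (fun ξ => (Complex.I * (ξ : ℂ)) ^ (α : ℂ) * density u ξ) := by
  ext x
  rw [rlDerivLeft, iteratedDeriv_succ, iteratedDeriv_one,
    (hu.hasDerivAt_deriv_rlIntegralLeft hα hα' hαs x).deriv]

lemma MemC.rlLeftExists {s : ℝ} {u : ℝ → ℂ} (hu : MemC s u) {α : ℝ}
    (hα : 1 < α) (hα' : α ≤ 2) (hαs : α ≤ s) : RLLeftExists α u := by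
  refine ⟨fun h2 x => ?_, fun x => (hu.hasDerivAt_rlIntegralLeft hα hα' hαs x).differentiableAt,
    fun x => (hu.hasDerivAt_deriv_rlIntegralLeft hα hα' hαs x).differentiableAt⟩
  have h := hu.integrableOn_rl (by linarith) (β := 2 - α) (by linarith) (by linarith) x
  rw [← (sub_left_measurePreserving_measurableEmbedding x).1.integrableOn_comp_preimage
    (sub_left_measurePreserving_measurableEmbedding x).2]
  have : (fun t : ℝ => x - t) ⁻¹' Set.Iio x = Set.Ioi 0 := by ext t; simp
  rw [this]
  refine h.congr_fun (fun t ht => ?_) measurableSet_Ioi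
  simp only [Function.comp]
  rw [rl_integrand_comp u _ x t ht]
  ring_nf

/-! ### Reflection -/

lemma rlIntegralRight_eq (β : ℝ) (u : ℝ → ℂ) (x : ℝ) :
    rlIntegralRight β u x = rlIntegralLeft β (fun y => u (-y)) (-x) := by
  unfold rlIntegralRight rlIntegralLeft
  split_ifs with h
  · simp
  · congr 1
    rw [← integral_Iic_eq_integral_Iio, ← integral_comp_neg_Ioi]
    congr 1; ext y
    ring_nf

lemma rlDerivRight_eq (α : ℝ) (u : ℝ → ℂ) (x : ℝ) :
    rlDerivRight α u x = rlDerivLeft α (fun y => u (-y)) (-x) := by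
  rw [rlDerivRight, rlDerivLeft,
    show rlIntegralRight (2 - α) u = fun x => rlIntegralLeft (2 - α) (fun y => u (-y)) (-x) from
      funext (rlIntegralRight_eq _ u), iteratedDeriv_comp_neg]
  simp

lemma RLLeftExists.right_of_reflection {α : ℝ} {u : ℝ → ℂ}
    (h : RLLeftExists α (fun y => u (-y))) : RLRightExists α u := by
  obtain ⟨h1, h2, h3⟩ := h
  have he : rlIntegralRight (2 - α) u = fun x => rlIntegralLeft (2 - α) (fun y => u (-y)) (-x) :=
    funext (rlIntegralRight_eq _ u)
  refine ⟨fun hα x => ?_, ?_, ?_⟩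
  · have := (h1 hα (-x)).comp_neg_Ioi
    refine this.congr_fun (fun t _ => ?_) measurableSet_Ioi |>.mono_set (by simp)
    simp only [neg_neg]
    ring_nf
  · rw [he]; exact h2.comp differentiable_neg
  · have hd : deriv (rlIntegralRight (2 - α) u) =
        fun x => -deriv (rlIntegralLeft (2 - α) (fun y => u (-y))) (-x) := by
      rw [he]; ext x; exact deriv_comp_neg _ _
    rw [hd]; exact (h3.comp differentiable_neg).neg

/-- The right Riemann–Liouville derivative is the multiplier `(-iξ)^α`. -/
lemma MemC.rlDerivRight_eq_synth {s : ℝ} {u : ℝ → ℂ} (hu : MemC s u) {α : ℝ}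
    (hα : 1 < α) (hα' : α ≤ 2) (hαs : α ≤ s) :
    rlDerivRight α u = synth (fun ξ => (-(Complex.I * (ξ : ℂ))) ^ (α : ℂ) * density u ξ) := by
  ext x
  rw [rlDerivRight_eq, hu.comp_neg.rlDerivLeft_eq hα hα' hαs, ← synth_comp_neg]
  simp [density_comp_neg]

/-! ### Truncated hypersingular integrals of superpositions -/

lemma integrableOn_abs_rpow_compl {r ε : ℝ} (hr : r < -1) (hε : 0 < ε) :
    IntegrableOn (fun t : ℝ => |t| ^ r) {t : ℝ | ε < |t|} := by
  have h1 : IntegrableOn (fun t : ℝ => |t| ^ r) (Set.Ioi ε) := by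
    refine (integrableOn_Ioi_rpow_of_lt hr hε).congr_fun (fun t ht => ?_) measurableSet_Ioi
    rw [abs_of_pos (hε.trans ht)]
  have h2 : IntegrableOn (fun t : ℝ => |t| ^ r) (Set.Iio (-ε)) := by
    have := IntegrableOn.comp_neg_Iio (c := -ε) (f := fun t : ℝ => |t| ^ r) (by rwa [neg_neg])
    simpa using this
  refine (h1.union h2).mono_set fun t ht => ?_
  rcases lt_abs.1 (show ε < |t| from ht) with h | h
  · exact Or.inl h
  · exact Or.inr (by simp only [Set.mem_Iio]; linarith)

lemma measurableSet_lt_abs (ε : ℝ) : MeasurableSet {t : ℝ | ε < |t|} :=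
  measurableSet_lt measurable_const (by fun_prop)

/-- A function that is `O(t²)` near zero and bounded is integrable against `|t|^{-1-α}`. -/
lemma integrable_mul_abs_rpow {α : ℝ} (hα : 1 < α) (hα' : α < 2) {g : ℝ → ℝ} (hg : Measurable g)
    {A B : ℝ} (hA : ∀ t, |g t| ≤ A * t ^ 2) (hB : ∀ t, |g t| ≤ B) :
    Integrable (fun t : ℝ => g t * |t| ^ (-(1 + α))) := by
  have h1 : Integrable ((Set.Icc (-1 : ℝ) 1).indicator (fun t : ℝ => A * |t| ^ (1 - α))) := by
    rw [integrable_indicator_iff measurableSet_Icc]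
    exact Integrable.const_mul (integrableOn_abs_rpow_Icc (by linarith)) _
  have h2 : Integrable ({t : ℝ | 1 < |t|}.indicator (fun t : ℝ => B * |t| ^ (-(1 + α)))) := by
    rw [integrable_indicator_iff (measurableSet_lt_abs 1)]
    exact Integrable.const_mul (integrableOn_abs_rpow_compl (by linarith) one_pos) _
  refine (h1.add h2).mono' (Measurable.mul hg (by fun_prop)).aestronglyMeasurable ?_
  refine Eventually.of_forall fun t => ?_
  have h0 : 0 ≤ |t| ^ (-(1 + α)) := Real.rpow_nonneg (abs_nonneg _) _
  rw [norm_mul, Real.norm_of_nonneg h0, Real.norm_eq_abs, Pi.add_apply]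
  by_cases ht : |t| ≤ 1
  · rw [Set.indicator_of_mem (show t ∈ Set.Icc (-1 : ℝ) 1 from abs_le.1 ht),
      Set.indicator_of_notMem (by simpa using ht), add_zero]
    refine (mul_le_mul_of_nonneg_right (hA t) h0).trans_eq ?_
    rcases eq_or_ne t 0 with rfl | h
    · rw [abs_zero, Real.zero_rpow (by linarith), Real.zero_rpow (by linarith)]; simp
    · rw [← sq_abs, mul_assoc, ← Real.rpow_natCast, ← Real.rpow_add (abs_pos.2 h)]
      congr 2; push_cast; ring
  · rw [Set.indicator_of_notMem (fun h : t ∈ Set.Icc (-1 : ℝ) 1 => ht (abs_le.2 h)),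
      Set.indicator_of_mem (by simpa using ht), zero_add]
    exact mul_le_mul_of_nonneg_right (hB t) h0

/-- `∫ (1 - cos t) |t|^{-1-α} dt`. -/
def cosMoment (α : ℝ) : ℝ := ∫ t : ℝ, (1 - Real.cos t) * |t| ^ (-(1 + α))

lemma abs_one_sub_cos_le_sq (t : ℝ) : |1 - Real.cos t| ≤ 1 / 2 * t ^ 2 := by
  rw [abs_of_nonneg (by linarith [Real.cos_le_one t])]
  linarith [Real.one_sub_sq_div_two_le_cos (x := t)]

lemma abs_one_sub_cos_le_two (t : ℝ) : |1 - Real.cos t| ≤ 2 := by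
  rw [abs_of_nonneg (by linarith [Real.cos_le_one t])]
  linarith [Real.neg_one_le_cos t]

lemma integrable_one_sub_cos {α : ℝ} (hα : 1 < α) (hα' : α < 2) (ξ : ℝ) :
    Integrable (fun t : ℝ => (1 - Real.cos (ξ * t)) * |t| ^ (-(1 + α))) := by
  refine integrable_mul_abs_rpow hα hα' (by fun_prop) (A := 1 / 2 * ξ ^ 2) (B := 2)
    (fun t => ?_) fun t => abs_one_sub_cos_le_two _
  refine (abs_one_sub_cos_le_sq _).trans_eq (by ring)

lemma integral_one_sub_cos {α : ℝ} (hα : 1 < α) (ξ : ℝ) :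
    ∫ t : ℝ, (1 - Real.cos (ξ * t)) * |t| ^ (-(1 + α)) = |ξ| ^ α * cosMoment α := by
  rcases eq_or_ne ξ 0 with rfl | h
  · simp [Real.zero_rpow (show α ≠ 0 by linarith)]
  · have h1 := Measure.integral_comp_mul_left
      (fun t : ℝ => (1 - Real.cos t) * |t| ^ (-(1 + α))) ξ
    have hp := abs_pos.2 h
    rw [cosMoment]
    have h2 : ∀ t : ℝ, (1 - Real.cos (ξ * t)) * |t| ^ (-(1 + α)) =
        |ξ| ^ (1 + α) * ((1 - Real.cos (ξ * t)) * |ξ * t| ^ (-(1 + α))) := by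
      intro t
      rw [abs_mul, Real.mul_rpow hp.le (abs_nonneg _), Real.rpow_neg hp.le]
      field_simp
    simp_rw [h2]
    rw [integral_const_mul, h1, smul_eq_mul, ← mul_assoc, abs_inv, Real.rpow_add hp,
      Real.rpow_one]
    field_simp

/-- The multiplier of the hypersingular integral truncated to `|t| > ε`. -/
def truncMultiplier (α ε ξ : ℝ) : ℝ :=
  ∫ t in {t : ℝ | ε < |t|}, (1 - Real.cos (ξ * t)) * |t| ^ (-(1 + α))

lemma abs_truncMultiplier_le {α : ℝ} (hα : 1 < α) (hα' : α < 2) (ε ξ : ℝ) :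
    |truncMultiplier α ε ξ| ≤ |ξ| ^ α * cosMoment α := by
  have h0 : ∀ t : ℝ, 0 ≤ (1 - Real.cos (ξ * t)) * |t| ^ (-(1 + α)) := fun t =>
    mul_nonneg (by linarith [Real.cos_le_one (ξ * t)]) (Real.rpow_nonneg (abs_nonneg _) _)
  rw [← integral_one_sub_cos hα, truncMultiplier, abs_of_nonneg (integral_nonneg h0)]
  exact setIntegral_le_integral (integrable_one_sub_cos hα hα' ξ) (Eventually.of_forall h0)

/-- For an integrable function no principal value is needed. -/
lemma tendsto_setIntegral_lt_abs {g : ℝ → ℝ} (hg : Integrable g) :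
    Tendsto (fun ε : ℝ => ∫ t in {t : ℝ | ε < |t|}, g t) (𝓝[>] 0) (𝓝 (∫ t, g t)) := by
  simp_rw [← integral_indicator (measurableSet_lt_abs _)]
  refine tendsto_integral_filter_of_dominated_convergence (fun t => ‖g t‖) ?_ ?_ hg.norm ?_
  · exact Eventually.of_forall fun ε => hg.aestronglyMeasurable.indicator (measurableSet_lt_abs ε)
  · exact Eventually.of_forall fun ε =>
      Eventually.of_forall fun t => norm_indicator_le_norm_self _ _
  · have h0 : ∀ᵐ t : ℝ, t ≠ 0 := by simp [ae_iff]
    filter_upwards [h0] with t ht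
    refine tendsto_const_nhds.congr' ?_
    filter_upwards [nhdsWithin_le_nhds (gt_mem_nhds (abs_pos.2 ht))] with ε hε
    rw [Set.indicator_of_mem (show t ∈ {t : ℝ | ε < |t|} from hε)]

lemma tendsto_truncMultiplier {α : ℝ} (hα : 1 < α) (hα' : α < 2) (ξ : ℝ) :
    Tendsto (fun ε => truncMultiplier α ε ξ) (𝓝[>] 0) (𝓝 (|ξ| ^ α * cosMoment α)) := by
  rw [← integral_one_sub_cos hα]
  exact tendsto_setIntegral_lt_abs (integrable_one_sub_cos hα hα' ξ)

/-- The sine part of the truncated multiplier vanishes by oddness. -/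
lemma integral_one_sub_exp {α ε : ℝ} (hα : 1 < α) (hα' : α < 2) (hε : 0 < ε) (ξ : ℝ) :
    ∫ t in {t : ℝ | ε < |t|}, (1 - Complex.exp (Complex.I * (ξ : ℂ) * ((-t : ℝ) : ℂ))) *
      ((|t| ^ (-(1 + α)) : ℝ) : ℂ) = (truncMultiplier α ε ξ : ℂ) := by
  have hp : IntegrableOn (fun t : ℝ => |t| ^ (-(1 + α))) {t : ℝ | ε < |t|} :=
    integrableOn_abs_rpow_compl (by linarith) hε
  have hsin : IntegrableOn (fun t : ℝ => Real.sin (ξ * t) * |t| ^ (-(1 + α)))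
      {t : ℝ | ε < |t|} := by
    refine hp.bdd_mul (c := 1) (Continuous.aestronglyMeasurable (by fun_prop)) ?_
    exact Eventually.of_forall fun t => Real.abs_sin_le_one _
  have hodd : ∫ t in {t : ℝ | ε < |t|}, Real.sin (ξ * t) * |t| ^ (-(1 + α)) = 0 := by
    rw [← integral_indicator (measurableSet_lt_abs ε)]
    set f := {t : ℝ | ε < |t|}.indicator fun t : ℝ => Real.sin (ξ * t) * |t| ^ (-(1 + α)) with hf
    have h1 : ∀ t, f (-t) = -f t := by
      intro t
      simp only [hf, Set.indicator_apply, Set.mem_ofPred_eq, abs_neg, mul_neg, Real.sin_neg]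
      split_ifs <;> ring
    have h2 := integral_neg_eq_self f volume
    simp_rw [h1, integral_neg] at h2
    linarith
  have hcos := (integrable_one_sub_cos hα hα' ξ).integrableOn (s := {t : ℝ | ε < |t|})
  have heq : ∀ t : ℝ, (1 - Complex.exp (Complex.I * (ξ : ℂ) * ((-t : ℝ) : ℂ))) *
      ((|t| ^ (-(1 + α)) : ℝ) : ℂ) = (((1 - Real.cos (ξ * t)) * |t| ^ (-(1 + α)) : ℝ) : ℂ) +
        Complex.I * ((Real.sin (ξ * t) * |t| ^ (-(1 + α)) : ℝ) : ℂ) := by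
    intro t
    have : Complex.I * (ξ : ℂ) * ((-t : ℝ) : ℂ) = ((-(ξ * t) : ℝ) : ℂ) * Complex.I := by
      push_cast; ring
    rw [this, Complex.exp_mul_I, ← Complex.ofReal_cos, ← Complex.ofReal_sin, Real.cos_neg,
      Real.sin_neg]
    push_cast; ring
  simp_rw [heq]
  rw [integral_add hcos.ofReal (hsin.ofReal.const_mul _), integral_const_mul,
    integral_complex_ofReal, integral_complex_ofReal, hodd, truncMultiplier]
  simp

/-- Fubini for the truncated hypersingular integral of a superposition. -/
lemma integral_trunc_synth {α ε : ℝ} (hα : 1 < α) (hα' : α < 2) (hε : 0 < ε) {w : ℝ → ℂ}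
    (hw : Integrable w) (x : ℝ) :
    ∫ t in {t : ℝ | ε < |t|}, (synth w x - synth w (x - t)) * ((|t| ^ (-(1 + α)) : ℝ) : ℂ) =
      synth (fun ξ => (truncMultiplier α ε ξ : ℂ) * w ξ) x := by
  have hp : IntegrableOn (fun t : ℝ => ((|t| ^ (-(1 + α)) : ℝ) : ℂ)) {t : ℝ | ε < |t|} :=
    (integrableOn_abs_rpow_compl (by linarith) hε).ofReal
  have hprod : Integrable (Function.uncurry fun (t ξ : ℝ) =>
      ((1 - Complex.exp (Complex.I * (ξ : ℂ) * ((-t : ℝ) : ℂ))) * ((|t| ^ (-(1 + α)) : ℝ) : ℂ)) *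
        (w ξ * Complex.exp (Complex.I * (ξ : ℂ) * (x : ℂ))))
      ((volume.restrict {t : ℝ | ε < |t|}).prod volume) := by
    have h2 := Integrable.mul_prod hp (integrable_mul_exp hw x)
    have h3 := h2.bdd_mul (c := 2)
      (f := fun z : ℝ × ℝ => 1 - Complex.exp (Complex.I * (z.2 : ℂ) * ((-z.1 : ℝ) : ℂ)))
      (Continuous.aestronglyMeasurable (by fun_prop))
      (Eventually.of_forall fun z => (norm_sub_le _ _).trans_eq (by
        rw [norm_exp_I_mul, norm_one]; norm_num))
    refine h3.congr (Eventually.of_forall fun z => ?_)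
    simp only [Function.uncurry]
    ring
  have hL : ∀ t : ℝ, (synth w x - synth w (x - t)) * ((|t| ^ (-(1 + α)) : ℝ) : ℂ) =
      ∫ ξ : ℝ, ((1 - Complex.exp (Complex.I * (ξ : ℂ) * ((-t : ℝ) : ℂ))) *
        ((|t| ^ (-(1 + α)) : ℝ) : ℂ)) * (w ξ * Complex.exp (Complex.I * (ξ : ℂ) * (x : ℂ))) := by
    intro t
    rw [sub_eq_add_neg x t, synth_translate w x (-t), ← synth_sub hw (integrable_mul_exp hw _),
      synth, ← integral_mul_const]
    congr 1; ext ξ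
    ring
  simp only [hL]
  rw [integral_integral_swap hprod, synth]
  congr 1; ext ξ
  rw [integral_mul_const, integral_one_sub_exp hα hα' hε]
  ring

/-- The hypersingular integral of a superposition acts as the multiplier `|ξ|^α`, up to the
constant `cosMoment α`. -/
lemma tendsto_trunc_synth {α : ℝ} (hα : 1 < α) (hα' : α < 2) {w : ℝ → ℂ}
    (hw : Integrable w) (hw' : Integrable (fun ξ : ℝ => |ξ| ^ α * ‖w ξ‖)) (x : ℝ) :
    Tendsto (fun ε : ℝ => ∫ t in {t : ℝ | ε < |t|},
      (synth w x - synth w (x - t)) * ((|t| ^ (-(1 + α)) : ℝ) : ℂ)) (𝓝[>] 0)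
      (𝓝 ((cosMoment α : ℂ) * synth (fun ξ => ((|ξ| ^ α : ℝ) : ℂ) * w ξ) x)) := by
  have h : Tendsto (fun ε : ℝ => synth (fun ξ => (truncMultiplier α ε ξ : ℂ) * w ξ) x) (𝓝[>] 0)
      (𝓝 (synth (fun ξ => ((|ξ| ^ α * cosMoment α : ℝ) : ℂ) * w ξ) x)) := by
    unfold synth
    refine tendsto_integral_filter_of_dominated_convergence
      (fun ξ => |ξ| ^ α * ‖w ξ‖ * cosMoment α) ?_ ?_ (hw'.mul_const _) ?_
    · refine Eventually.of_forall fun ε => ?_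
      refine AEStronglyMeasurable.mul (AEStronglyMeasurable.mul ?_ hw.aestronglyMeasurable)
        (Continuous.aestronglyMeasurable (by fun_prop))
      have : StronglyMeasurable (fun ξ : ℝ => truncMultiplier α ε ξ) := by
        unfold truncMultiplier
        refine StronglyMeasurable.integral_prod_right
          (f := fun (ξ t : ℝ) => (1 - Real.cos (ξ * t)) * |t| ^ (-(1 + α))) ?_
        refine Measurable.stronglyMeasurable ?_
        simp only [Function.uncurry_def]
        exact Measurable.mul (by fun_prop) (by fun_prop)
      exact (Complex.measurable_ofReal.comp this.measurable).aestronglyMeasurable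
    · refine Eventually.of_forall fun ε => Eventually.of_forall fun ξ => ?_
      rw [norm_mul, norm_exp_I_mul, mul_one, norm_mul, Complex.norm_real, Real.norm_eq_abs,
        mul_right_comm]
      exact mul_le_mul_of_nonneg_right (abs_truncMultiplier_le hα hα' ε ξ) (norm_nonneg _)
    · refine Eventually.of_forall fun ξ => ?_
      exact (((Complex.continuous_ofReal.tendsto _).comp
        (tendsto_truncMultiplier hα hα' ξ)).mul_const _).mul_const _
  rw [← synth_const_mul]
  have h' : synth (fun ξ => (cosMoment α : ℂ) * (((|ξ| ^ α : ℝ) : ℂ) * w ξ)) x =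
      synth (fun ξ => ((|ξ| ^ α * cosMoment α : ℝ) : ℂ) * w ξ) x := by
    congr 1; ext ξ; push_cast; ring
  rw [h']
  refine h.congr' ?_
  filter_upwards [self_mem_nhdsWithin] with ε hε
  exact (integral_trunc_synth hα hα' hε hw x).symm

/-! ### The normalising constant -/

lemma abs_one_sub_gaussian_le_sq (t : ℝ) : |1 - Real.exp (-t ^ 2)| ≤ 1 * t ^ 2 := by
  have h1 : Real.exp (-t ^ 2) ≤ 1 := Real.exp_le_one_iff.2 (by nlinarith [sq_nonneg t])
  rw [abs_of_nonneg (by linarith)]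
  linarith [Real.add_one_le_exp (-t ^ 2)]

lemma abs_one_sub_gaussian_le_one (t : ℝ) : |1 - Real.exp (-t ^ 2)| ≤ 1 := by
  have h1 : Real.exp (-t ^ 2) ≤ 1 := Real.exp_le_one_iff.2 (by nlinarith [sq_nonneg t])
  rw [abs_of_nonneg (by linarith)]
  linarith [Real.exp_pos (-t ^ 2)]

lemma integrable_one_sub_gaussian {α : ℝ} (hα : 1 < α) (hα' : α < 2) :
    Integrable (fun t : ℝ => (1 - Real.exp (-t ^ 2)) * |t| ^ (-(1 + α))) :=
  integrable_mul_abs_rpow hα hα' (by fun_prop) abs_one_sub_gaussian_le_sq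
    abs_one_sub_gaussian_le_one

lemma integral_one_sub_gaussian {α : ℝ} (hα : 1 < α) (hα' : α < 2) :
    ∫ t : ℝ, (1 - Real.exp (-t ^ 2)) * |t| ^ (-(1 + α)) = 2 / α * Real.Gamma (1 - α / 2) := by
  have h1 := integral_comp_abs (f := fun t : ℝ => (1 - Real.exp (-t ^ 2)) * t ^ (-(1 + α)))
  simp only [sq_abs] at h1
  have hα0 : α ≠ 0 := by linarith
  have hint : IntegrableOn (fun t : ℝ => t ^ (1 - α) * Real.exp (-(1 : ℝ) * t ^ (2 : ℝ)))
      (Set.Ioi 0) :=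
    integrableOn_rpow_mul_exp_neg_mul_rpow (by linarith) (by norm_num) one_pos
  have hparts := integral_Ioi_mul_deriv_eq_deriv_mul (a := 0) (a' := (0 : ℝ)) (b' := 0)
    (u := fun t : ℝ => 1 - Real.exp (-t ^ 2)) (u' := fun t => 2 * t * Real.exp (-t ^ 2))
    (v := fun t : ℝ => -(t ^ (-α) / α)) (v' := fun t => t ^ (-(1 + α)))
    (fun t _ => by
      have := ((hasDerivAt_pow 2 t).fun_neg.exp).const_sub 1
      refine this.congr_deriv ?_
      push_cast; ring)
    (fun t ht => by
      have := ((Real.hasDerivAt_rpow_const (p := -α) (Or.inl (ne_of_gt ht))).div_const α).fun_neg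
      refine this.congr_deriv ?_
      rw [show -(1 + α) = -α - 1 by ring]
      field_simp)
    ?_ ?_ ?_ ?_
  · rw [h1, hparts]
    have h2 : ∀ t ∈ Set.Ioi (0 : ℝ), 2 * t * Real.exp (-t ^ 2) * -(t ^ (-α) / α) =
        -(2 / α) * (t ^ (1 - α) * Real.exp (-(1 : ℝ) * t ^ (2 : ℝ))) := by
      intro t ht
      rw [sub_eq_add_neg 1 α, Real.rpow_add ht, Real.rpow_one, Real.rpow_two, neg_one_mul]
      ring
    rw [setIntegral_congr_fun measurableSet_Ioi h2, integral_const_mul,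
      integral_rpow_mul_exp_neg_mul_rpow (by norm_num) (by linarith) one_pos, Real.one_rpow]
    rw [show (1 - α + 1) / 2 = 1 - α / 2 by ring]
    ring
  · refine (integrable_one_sub_gaussian hα hα').integrableOn.congr_fun (fun t ht => ?_)
      measurableSet_Ioi
    simp only [Pi.mul_apply]
    rw [abs_of_pos ht]
  · have hint' : IntegrableOn (fun t : ℝ => -(2 / α) *
        (t ^ (1 - α) * Real.exp (-(1 : ℝ) * t ^ (2 : ℝ)))) (Set.Ioi 0) := hint.const_mul _
    refine hint'.congr_fun (fun t ht => ?_) measurableSet_Ioi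
    simp only [Pi.mul_apply]
    rw [sub_eq_add_neg 1 α, Real.rpow_add ht, Real.rpow_one, Real.rpow_two, neg_one_mul]
    ring
  · have hz : Tendsto (fun t : ℝ => t ^ (2 - α) / α) (𝓝[>] 0) (𝓝 0) := by
      have hc : ContinuousAt (fun t : ℝ => t ^ (2 - α) / α) 0 :=
        (Real.continuousAt_rpow_const 0 _ (Or.inr (by linarith))).div_const _
      have := hc.tendsto.mono_left (nhdsWithin_le_nhds (s := Set.Ioi 0))
      simpa [Real.zero_rpow (show 2 - α ≠ 0 by linarith)] using this
    refine squeeze_zero_norm' ?_ hz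
    filter_upwards [self_mem_nhdsWithin] with t ht
    have ht' : 0 < t := ht
    have h3 : 0 ≤ t ^ (-α) / α := div_nonneg (Real.rpow_nonneg ht'.le _) (by linarith)
    rw [Pi.mul_apply, norm_mul, norm_neg, Real.norm_of_nonneg h3, Real.norm_eq_abs]
    refine (mul_le_mul_of_nonneg_right (abs_one_sub_gaussian_le_sq t) h3).trans_eq ?_
    rw [sub_eq_add_neg 2 α, Real.rpow_add ht', Real.rpow_two]
    ring
  · have hz : Tendsto (fun t : ℝ => t ^ (-α) / α) atTop (𝓝 0) := by
      simpa using (tendsto_rpow_neg_atTop (show 0 < α by linarith)).div_const α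
    refine squeeze_zero_norm' ?_ hz
    filter_upwards [eventually_gt_atTop 0] with t ht
    have h3 : 0 ≤ t ^ (-α) / α := div_nonneg (Real.rpow_nonneg ht.le _) (by linarith)
    rw [Pi.mul_apply, norm_mul, norm_neg, Real.norm_of_nonneg h3, Real.norm_eq_abs]
    exact mul_le_of_le_one_left h3 (abs_one_sub_gaussian_le_one t)

/-- The Gaussian `e^{-x²}` as a superposition of plane waves. -/
lemma synth_gaussian (x : ℝ) :
    synth (fun ξ => ((Real.exp (-(1 / 4) * ξ ^ 2) / (2 * Real.sqrt Real.pi) : ℝ) : ℂ)) x =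
      ((Real.exp (-x ^ 2) : ℝ) : ℂ) := by
  have h := fourierIntegral_gaussian (b := 1 / 4) (by norm_num) (x : ℂ)
  have hs : ((Real.pi : ℂ) / (1 / 4)) ^ (1 / 2 : ℂ) = ((2 * Real.sqrt Real.pi : ℝ) : ℂ) := by
    have h1 : ((Real.pi : ℂ) / (1 / 4)) = ((4 * Real.pi : ℝ) : ℂ) := by push_cast; ring
    have h2 : (1 / 2 : ℂ) = ((1 / 2 : ℝ) : ℂ) := by push_cast; ring
    rw [h1, h2, ← Complex.ofReal_cpow (by positivity), ← Real.sqrt_eq_rpow,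
      Real.sqrt_mul (by norm_num), show (4 : ℝ) = 2 ^ 2 by norm_num, Real.sqrt_sq (by norm_num)]
  have hs0 : ((2 * Real.sqrt Real.pi : ℝ) : ℂ) ≠ 0 := by
    have : 0 < 2 * Real.sqrt Real.pi := by positivity
    exact_mod_cast this.ne'
  have hx : Complex.exp (-(x : ℂ) ^ 2 / (4 * (1 / 4))) = ((Real.exp (-x ^ 2) : ℝ) : ℂ) := by
    push_cast; congr 1; ring
  rw [hs, hx] at h
  rw [← mul_right_inj' hs0, ← h, synth, ← integral_const_mul]
  congr 1; ext ξ
  rw [Complex.ofReal_div, ← mul_assoc, mul_div_cancel₀ _ hs0, mul_comm]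
  push_cast
  ring_nf

lemma integral_abs_rpow_mul_gaussian {α : ℝ} (hα : 1 < α) :
    ∫ ξ : ℝ, |ξ| ^ α * Real.exp (-(1 / 4) * ξ ^ 2) =
      2 ^ (α + 1) * Real.Gamma ((1 + α) / 2) := by
  have h1 := integral_comp_abs (f := fun t : ℝ => t ^ α * Real.exp (-(1 / 4) * t ^ (2 : ℝ)))
  simp only [Real.rpow_two, sq_abs] at h1
  have h2 := integral_rpow_mul_exp_neg_mul_rpow (p := 2) (q := α) (b := 1 / 4) (by norm_num)
    (by linarith) (by norm_num)
  simp only [Real.rpow_two] at h2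
  have h3 : (1 / 4 : ℝ) ^ (-(α + 1) / 2) = 2 ^ (α + 1) := by
    rw [show (1 / 4 : ℝ) = 2 ^ (-2 : ℝ) by rw [Real.rpow_neg (by norm_num)]; norm_num,
      ← Real.rpow_mul (by norm_num)]
    congr 1; ring
  rw [h1, h2, h3, add_comm α 1]
  ring

lemma integrable_abs_rpow_mul_gaussian {r : ℝ} (hr : 0 ≤ r) :
    Integrable (fun ξ : ℝ => |ξ| ^ r * Real.exp (-(1 / 4) * ξ ^ 2)) := by
  have h1 : IntegrableOn (fun ξ : ℝ => |ξ| ^ r * Real.exp (-(1 / 4) * ξ ^ 2)) (Set.Ioi 0) := by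
    refine (integrable_rpow_mul_exp_neg_mul_sq (b := 1 / 4) (by norm_num) (s := r)
      (by linarith)).integrableOn.congr_fun (fun ξ hξ => ?_) measurableSet_Ioi
    simp only
    rw [abs_of_pos hξ]
  have h2 : IntegrableOn (fun ξ : ℝ => |ξ| ^ r * Real.exp (-(1 / 4) * ξ ^ 2)) (Set.Iio 0) := by
    have := IntegrableOn.comp_neg_Iio (c := 0)
      (f := fun ξ : ℝ => |ξ| ^ r * Real.exp (-(1 / 4) * ξ ^ 2)) (by rwa [neg_zero])
    simpa using this
  have h3 : IntegrableOn (fun ξ : ℝ => |ξ| ^ r * Real.exp (-(1 / 4) * ξ ^ 2)) {0} := by simp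
  rw [← integrableOn_univ]
  refine ((h1.union h2).union h3).mono_set fun ξ _ => ?_
  rcases lt_trichotomy ξ 0 with h | h | h
  · exact Or.inl (Or.inr h)
  · exact Or.inr h
  · exact Or.inl (Or.inl h)

/-- The constant `K_α` normalises the multiplier of the fractional Laplacian. Both constants are
compared by evaluating the hypersingular integral of the Gaussian `e^{-x²}` at `x = 0` directly and
in frequency space. -/
lemma lapConst_mul_cosMoment {α : ℝ} (hα : 1 < α) (hα' : α < 2) :
    lapConst α * cosMoment α = 1 := by
  set w : ℝ → ℂ := fun ξ =>
    ((Real.exp (-(1 / 4) * ξ ^ 2) / (2 * Real.sqrt Real.pi) : ℝ) : ℂ) with hw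
  have hwi : Integrable w := by
    have := ((integrable_abs_rpow_mul_gaussian le_rfl).div_const (2 * Real.sqrt Real.pi)).ofReal
      (𝕜 := ℂ)
    simpa [hw] using this
  have hwi' : Integrable (fun ξ : ℝ => |ξ| ^ α * ‖w ξ‖) := by
    refine ((integrable_abs_rpow_mul_gaussian (show 0 ≤ α by linarith)).div_const
      (2 * Real.sqrt Real.pi)).congr (Eventually.of_forall fun ξ => ?_)
    simp only [hw]
    rw [Complex.norm_real, Real.norm_of_nonneg (by positivity), mul_div_assoc]
  have hlim := tendsto_trunc_synth hα hα' hwi hwi' 0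
  have hlim' : Tendsto (fun ε : ℝ => ∫ t in {t : ℝ | ε < |t|},
      (synth w 0 - synth w (0 - t)) * ((|t| ^ (-(1 + α)) : ℝ) : ℂ)) (𝓝[>] 0)
      (𝓝 ((2 / α * Real.Gamma (1 - α / 2) : ℝ) : ℂ)) := by
    have h := (Complex.continuous_ofReal.tendsto _).comp
      (tendsto_setIntegral_lt_abs (integrable_one_sub_gaussian hα hα'))
    rw [integral_one_sub_gaussian hα hα'] at h
    refine h.congr fun ε => ?_
    simp only [Function.comp]
    rw [← integral_complex_ofReal]
    congr 1; ext t
    rw [hw, synth_gaussian, synth_gaussian]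
    simp
  have hval : synth (fun ξ => ((|ξ| ^ α : ℝ) : ℂ) * w ξ) 0 =
      ((2 ^ (α + 1) * Real.Gamma ((1 + α) / 2) / (2 * Real.sqrt Real.pi) : ℝ) : ℂ) := by
    rw [← integral_abs_rpow_mul_gaussian hα, ← integral_div, ← integral_complex_ofReal, synth]
    congr 1; ext ξ
    simp only [hw]
    push_cast
    simp [mul_div_assoc]
  have hkey := tendsto_nhds_unique hlim' hlim
  rw [hval, ← Complex.ofReal_mul] at hkey
  have hkey' := Complex.ofReal_injective hkey
  have hG : Real.Gamma (1 - α / 2) = -(α / 2) * Real.Gamma (-(α / 2)) := by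
    rw [← Real.Gamma_add_one (by linarith)]
    congr 1; ring
  have hGpos : 0 < Real.Gamma (1 - α / 2) := Real.Gamma_pos_of_pos (by linarith)
  have habs : |Real.Gamma (-(α / 2))| = 2 / α * Real.Gamma (1 - α / 2) := by
    have hneg : Real.Gamma (-(α / 2)) < 0 := by
      by_contra h
      push Not at h
      nlinarith
    rw [abs_of_neg hneg, hG]
    field_simp
  have hπ : 0 < Real.sqrt Real.pi := Real.sqrt_pos.2 Real.pi_pos
  rw [lapConst, habs, hkey', Real.rpow_add_one two_ne_zero]
  have hc : 0 < 2 / α * Real.Gamma (1 - α / 2) := by positivity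
  rw [hkey'] at hc
  have hG2 : 0 < Real.Gamma ((1 + α) / 2) := Real.Gamma_pos_of_pos (by linarith)
  have hc0 : cosMoment α ≠ 0 := fun h => by simp [h] at hc
  have h2 : (0 : ℝ) < 2 ^ α := by positivity
  field_simp

/-! ### The fractional Laplacian as a Fourier multiplier -/

lemma lapTrunc_eq (α : ℝ) (u : ℝ → ℂ) (x ε : ℝ) :
    lapTrunc α u x ε = ∫ t in {t : ℝ | ε < |t|},
      (u x - u (x - t)) * ((|t| ^ (-(1 + α)) : ℝ) : ℂ) := by
  rw [lapTrunc, ← (sub_left_measurePreserving_measurableEmbedding x).1.setIntegral_preimage_emb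
    (sub_left_measurePreserving_measurableEmbedding x).2]
  have : (fun t : ℝ => x - t) ⁻¹' {y : ℝ | ε < |x - y|} = {t : ℝ | ε < |t|} := by ext t; simp
  rw [this]
  congr 1; ext t
  rw [lapKernel, sub_sub_cancel, Real.rpow_neg (abs_nonneg t), div_eq_mul_inv, Complex.ofReal_inv]

lemma MemC.integrableOn_lapKernel {s : ℝ} (hs : 0 ≤ s) {u : ℝ → ℂ} (hu : MemC s u) {α : ℝ}
    (hα : 0 < α) (x : ℝ) {ε : ℝ} (hε : 0 < ε) :
    IntegrableOn (lapKernel α u x) {y : ℝ | ε < |x - y|} := by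
  obtain ⟨B, -, hub⟩ := hu.exists_bound hs
  rw [← (sub_left_measurePreserving_measurableEmbedding x).1.integrableOn_comp_preimage
    (sub_left_measurePreserving_measurableEmbedding x).2]
  have : (fun t : ℝ => x - t) ⁻¹' {y : ℝ | ε < |x - y|} = {t : ℝ | ε < |t|} := by ext t; simp
  rw [this]
  have hp : IntegrableOn (fun t : ℝ => ((|t| ^ (-(1 + α)) : ℝ) : ℂ)) {t : ℝ | ε < |t|} :=
    (integrableOn_abs_rpow_compl (by linarith) hε).ofReal
  have h := hp.bdd_mul (c := B + B) (f := fun t => u x - u (x - t))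
    (Continuous.aestronglyMeasurable (by have := hu.continuous; fun_prop))
    (Eventually.of_forall fun t => (norm_sub_le _ _).trans (add_le_add (hub _) (hub _)))
  refine h.congr (Eventually.of_forall fun t => ?_)
  simp only [Function.comp]
  rw [lapKernel, sub_sub_cancel, Real.rpow_neg (abs_nonneg t), div_eq_mul_inv, Complex.ofReal_inv]

lemma MemC.tendsto_lapTrunc {s : ℝ} {u : ℝ → ℂ} (hu : MemC s u) {α : ℝ} (hα : 1 < α)
    (hα' : α < 2) (hαs : α ≤ s) (x : ℝ) :
    Tendsto (lapTrunc α u x) (𝓝[>] 0)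
      (𝓝 ((cosMoment α : ℂ) * synth (fun ξ => ((|ξ| ^ α : ℝ) : ℂ) * density u ξ) x)) := by
  have h := tendsto_trunc_synth hα hα' (hu.integrable_density (by linarith))
    (hu.integrable_rpow_mul_density (by linarith) (by linarith) hαs) x
  refine h.congr fun ε => ?_
  simp only [hu.synth_density (show 0 ≤ s by linarith)]
  exact (lapTrunc_eq α u x ε).symm

lemma MemC.hasDerivAt {s : ℝ} (hs : 1 ≤ s) {u : ℝ → ℂ} (hu : MemC s u) (x : ℝ) :
    HasDerivAt u (synth (fun ξ => (Complex.I * (ξ : ℂ)) ^ ((1 : ℝ) : ℂ) * density u ξ) x) x := by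
  have h := hu.hasDerivAt_synth_cpow (by linarith) (r := 0) (by norm_num) (by linarith) x
  simp only [Complex.ofReal_zero, Complex.cpow_zero, one_mul, zero_add] at h
  rwa [show synth (density u) = u from funext (hu.synth_density (by linarith))] at h

lemma MemC.hasDerivAt_deriv {s : ℝ} (hs : 2 ≤ s) {u : ℝ → ℂ} (hu : MemC s u) (x : ℝ) :
    HasDerivAt (deriv u)
      (synth (fun ξ => (Complex.I * (ξ : ℂ)) ^ ((2 : ℝ) : ℂ) * density u ξ) x) x := by
  rw [show deriv u = _ from funext fun x => (hu.hasDerivAt (by linarith) x).deriv]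
  have h := hu.hasDerivAt_synth_cpow (by linarith) (r := 1) (by norm_num) (by linarith) x
  rwa [show (1 : ℝ) + 1 = 2 by norm_num] at h

lemma MemC.fracLaplacianExists {s : ℝ} {u : ℝ → ℂ} (hu : MemC s u) {α : ℝ} (hα : 1 < α)
    (hαs : α ≤ s) : FracLaplacianExists α u := by
  refine ⟨fun h2 x => ⟨fun ε hε => hu.integrableOn_lapKernel (by linarith) (by linarith) x hε,
    _, hu.tendsto_lapTrunc hα h2 hαs x⟩, fun h2 => ⟨fun x => ?_, fun x => ?_⟩⟩
  · exact (hu.hasDerivAt (by linarith) x).differentiableAt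
  · exact (hu.hasDerivAt_deriv (by linarith) x).differentiableAt

/-- The fractional Laplacian is the multiplier `|ξ|^α`. -/
lemma MemC.fracLaplacian_eq {s : ℝ} {u : ℝ → ℂ} (hu : MemC s u) {α : ℝ} (hα : 1 < α)
    (hα' : α ≤ 2) (hαs : α ≤ s) :
    fracLaplacian α u = synth (fun ξ => ((|ξ| ^ α : ℝ) : ℂ) * density u ξ) := by
  ext x
  unfold fracLaplacian
  split_ifs with h2
  · subst h2
    rw [iteratedDeriv_succ, iteratedDeriv_one, (hu.hasDerivAt_deriv hαs x).deriv,
      neg_eq_neg_one_mul, ← synth_const_mul]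
    congr 1; ext ξ
    rw [show (((2 : ℝ) : ℝ) : ℂ) = 2 by norm_num, Complex.cpow_ofNat, mul_pow, Complex.I_sq,
      Real.rpow_two, sq_abs]
    push_cast; ring
  · have hlt : α < 2 := lt_of_le_of_ne hα' h2
    rw [(hu.tendsto_lapTrunc hα hlt hαs x).limUnder_eq, ← mul_assoc, ← Complex.ofReal_mul,
      lapConst_mul_cosMoment hα hlt, Complex.ofReal_one, one_mul]

lemma I_mul_cpow_add_neg {α : ℝ} (hα : 0 < α) (ξ : ℝ) :
    (Complex.I * (ξ : ℂ)) ^ (α : ℂ) + (-(Complex.I * (ξ : ℂ))) ^ (α : ℂ) =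
      ((2 * Real.cos (Real.pi * α / 2) * |ξ| ^ α : ℝ) : ℂ) := by
  have hI : (Complex.I) ^ (α : ℂ) + (-Complex.I) ^ (α : ℂ) =
      ((2 * Real.cos (Real.pi * α / 2) : ℝ) : ℂ) := by
    rw [Complex.cpow_def_of_ne_zero Complex.I_ne_zero,
      Complex.cpow_def_of_ne_zero (neg_ne_zero.2 Complex.I_ne_zero), Complex.log_I,
      Complex.log_neg_I]
    push_cast
    rw [Complex.two_cos]
    ring_nf
  rcases lt_trichotomy ξ 0 with h | h | h
  · have h1 : Complex.I * (ξ : ℂ) = ((-ξ : ℝ) : ℂ) * (-Complex.I) := by push_cast; ring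
    have h2 : -(Complex.I * (ξ : ℂ)) = ((-ξ : ℝ) : ℂ) * Complex.I := by push_cast; ring
    rw [h2, h1, ofReal_mul_cpow (by linarith), ofReal_mul_cpow (by linarith), ← mul_add, add_comm,
      hI, abs_of_neg h, Complex.ofReal_mul (2 * Real.cos _), Complex.ofReal_cpow (by linarith)]
    ring
  · subst h
    have hα' : (α : ℂ) ≠ 0 := by exact_mod_cast hα.ne'
    simp [Complex.zero_cpow hα', Real.zero_rpow hα.ne']
  · have h1 : Complex.I * (ξ : ℂ) = (ξ : ℂ) * Complex.I := mul_comm _ _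
    have h2 : -(Complex.I * (ξ : ℂ)) = (ξ : ℂ) * (-Complex.I) := by ring
    rw [h2, h1, ofReal_mul_cpow h, ofReal_mul_cpow h, ← mul_add, hI, abs_of_pos h,
      Complex.ofReal_mul (2 * Real.cos _), Complex.ofReal_cpow h.le]
    ring

lemma cos_pi_mul_div_two_ne_zero {α : ℝ} (hα : 1 < α) (hα' : α ≤ 2) :
    Real.cos (Real.pi * α / 2) ≠ 0 := by
  refine (Real.cos_neg_of_pi_div_two_lt_of_lt ?_ ?_).ne <;> nlinarith [Real.pi_pos]

/-- The fractional Laplacian is minus the Riesz derivative, because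
`(iξ)^α + (-iξ)^α = 2 cos(πα/2) |ξ|^α`. -/
lemma MemC.fracLaplacian_eq_neg_rieszDeriv {s : ℝ} {u : ℝ → ℂ} (hu : MemC s u) {α : ℝ}
    (hα : 1 < α) (hα' : α ≤ 2) (hαs : α ≤ s) (x : ℝ) :
    fracLaplacian α u x = -rieszDeriv α u x := by
  have hneg : Integrable (fun ξ : ℝ => (-(Complex.I * (ξ : ℂ))) ^ (α : ℂ) * density u ξ) := by
    have := (hu.comp_neg.integrable_cpow_mul_density (r := α)
      (by linarith) (by linarith) hαs).comp_neg
    simpa [density_comp_neg] using this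
  rw [rieszDeriv, hu.rlDerivLeft_eq hα hα' hαs, hu.rlDerivRight_eq_synth hα hα' hαs,
    ← synth_add (hu.integrable_cpow_mul_density (by linarith) (by linarith) hαs) hneg,
    ← synth_const_mul, hu.fracLaplacian_eq hα hα' hαs, neg_eq_neg_one_mul, ← synth_const_mul]
  congr 1; ext ξ
  rw [← add_mul, I_mul_cpow_add_neg (by linarith), ← mul_assoc, ← mul_assoc, rieszConst]
  congr 1
  have := cos_pi_mul_div_two_ne_zero hα hα'
  rw [show (-1 : ℂ) = ((-1 : ℝ) : ℂ) by norm_num, ← Complex.ofReal_mul, ← Complex.ofReal_mul]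
  congr 1
  field_simp

/-! ### Absolutely convergent Taylor coefficients of the generating function -/

/-- Taylor coefficients are determined by any convergent power series expansion. -/
lemma iteratedDeriv_div_factorial_eq {f : ℂ → ℂ} {c : ℕ → ℂ}
    (h : ∀ᶠ z in 𝓝 (0 : ℂ), HasSum (fun n => c n * z ^ n) (f z)) (n : ℕ) :
    iteratedDeriv n f 0 / (n ! : ℂ) = c n := by
  have h1 : HasFPowerSeriesAt f (FormalMultilinearSeries.ofScalars ℂ c) 0 := by
    rw [hasFPowerSeriesAt_iff]
    filter_upwards [h] with z hz
    simpa [FormalMultilinearSeries.coeff_ofScalars, mul_comm] using hz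
  have h2 := h1.eq_formalMultilinearSeries h1.analyticAt.hasFPowerSeriesAt
  rw [FormalMultilinearSeries.ofScalars_series_eq_iff] at h2
  exact (congrFun h2 n).symm

lemma choose_succ_eq (a : ℝ) (n : ℕ) :
    Ring.choose a (n + 1) = Ring.choose a n * ((a - n) / (n + 1)) := by
  have h1 := Ring.descPochhammer_eq_factorial_smul_choose a (n + 1)
  have h2 := Ring.descPochhammer_eq_factorial_smul_choose a n
  rw [descPochhammer_succ_right, Polynomial.smeval_mul, h2] at h1
  have hf : ((n ! : ℕ) : ℝ) ≠ 0 := by exact_mod_cast n.factorial_ne_zero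
  have hn : (n : ℝ) + 1 ≠ 0 := by positivity
  simp only [Polynomial.smeval_sub, Polynomial.smeval_X, Polynomial.smeval_natCast, pow_zero,
    pow_one, nsmul_eq_mul, mul_one, Nat.factorial_succ] at h1
  push_cast at h1
  field_simp
  apply mul_left_cancel₀ hf
  linarith

/-- The coefficient of `z^m` in `(1 - z)^α`. -/
def binomCoeff (α : ℝ) (m : ℕ) : ℝ := (-1) ^ m * Ring.choose α m

lemma binomCoeff_succ (α : ℝ) (m : ℕ) :
    binomCoeff α (m + 1) = binomCoeff α m * ((m - α) / (m + 1)) := by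
  rw [binomCoeff, binomCoeff, choose_succ_eq, pow_succ]
  ring

lemma sum_binomCoeff (α : ℝ) (n : ℕ) :
    ∑ m ∈ Finset.range (n + 1), binomCoeff α m = binomCoeff (α - 1) n := by
  induction n with
  | zero => simp [binomCoeff]
  | succ n ih =>
    rw [Finset.sum_range_succ, ih]
    have h := Ring.choose_succ_succ (α - 1) n
    rw [sub_add_cancel] at h
    rw [binomCoeff, binomCoeff, binomCoeff, h, pow_succ]
    ring

lemma abs_binomCoeff_sub_one_le {α : ℝ} (hα : 1 < α) (hα' : α ≤ 2) (n : ℕ) :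
    |binomCoeff (α - 1) n| ≤ 1 := by
  induction n with
  | zero => simp [binomCoeff]
  | succ n ih =>
    rw [binomCoeff_succ, abs_mul]
    refine mul_le_one₀ ih (abs_nonneg _) ?_
    have hn : (0 : ℝ) ≤ n := n.cast_nonneg
    rw [abs_le, le_div_iff₀ (by positivity), div_le_iff₀ (by positivity)]
    constructor <;> linarith

lemma binomCoeff_add_two_nonneg {α : ℝ} (hα : 1 < α) (hα' : α ≤ 2) (m : ℕ) :
    0 ≤ binomCoeff α (m + 2) := by
  induction m with
  | zero =>
    rw [binomCoeff_succ, binomCoeff_succ]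
    simp only [binomCoeff, Ring.choose_zero_right]
    norm_num
    nlinarith
  | succ m ih =>
    rw [show m + 1 + 2 = (m + 2) + 1 by ring, binomCoeff_succ]
    refine mul_nonneg ih (div_nonneg ?_ (by positivity))
    push_cast
    have hn : (0 : ℝ) ≤ m := m.cast_nonneg
    linarith

/-- From the second coefficient on, the coefficients of `(1 - z)^α` are nonnegative, and their
partial sums are bounded. -/
lemma summable_abs_binomCoeff {α : ℝ} (hα : 1 < α) (hα' : α ≤ 2) :
    Summable (fun m => |binomCoeff α m|) := by
  rw [← summable_nat_add_iff 2]
  have h : Summable (fun m => binomCoeff α (m + 2)) := by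
    refine summable_of_sum_range_le (c := α) (binomCoeff_add_two_nonneg hα hα') fun n => ?_
    have h1 := sum_binomCoeff α (n + 1)
    rw [Finset.sum_range_succ', Finset.sum_range_succ'] at h1
    have h2 := (abs_le.1 (abs_binomCoeff_sub_one_le hα hα' (n + 1))).2
    have h3 : binomCoeff α 0 = 1 := by simp [binomCoeff]
    have h4 : binomCoeff α (0 + 1) = -α := by simp [binomCoeff]
    rw [h3, h4] at h1
    linarith
  exact h.abs

lemma hasSum_binomCoeff_of_norm_lt (α : ℝ) {z : ℂ} (hz : ‖z‖ < 1) :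
    HasSum (fun m => (binomCoeff α m : ℂ) * z ^ m) ((1 - z) ^ (α : ℂ)) := by
  have h := (Complex.one_add_cpow_hasFPowerSeriesOnBall_zero (a := (α : ℂ))).hasSum (y := -z)
    (by rw [← ENNReal.ofReal_one, Metric.eball_ofReal]; simpa using hz)
  rw [zero_add, ← sub_eq_add_neg] at h
  refine h.congr_fun fun m => ?_
  rw [binomialSeries, FormalMultilinearSeries.ofScalars_apply_eq, ← Complex.ofReal_choose,
    binomCoeff, smul_eq_mul, neg_pow]
  push_cast; ring

/-- By absolute convergence the binomial series represents `(1 - z)^α` up to the boundary of the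
unit disc, including the branch point `z = 1`. -/
lemma hasSum_binomCoeff {α : ℝ} (hα : 1 < α) (hα' : α ≤ 2) {z : ℂ} (hz : ‖z‖ ≤ 1) :
    HasSum (fun m => (binomCoeff α m : ℂ) * z ^ m) ((1 - z) ^ (α : ℂ)) := by
  have hbound : ∀ m : ℕ, ∀ z ∈ Metric.closedBall (0 : ℂ) 1,
      ‖(binomCoeff α m : ℂ) * z ^ m‖ ≤ |binomCoeff α m| := by
    intro m z hz
    rw [norm_mul, norm_pow, Complex.norm_real, Real.norm_eq_abs]
    exact mul_le_of_le_one_right (abs_nonneg _) (pow_le_one₀ (norm_nonneg _) (by simpa using hz))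
  have hsum := summable_abs_binomCoeff hα hα'
  have hzmem : z ∈ Metric.closedBall (0 : ℂ) 1 := by simpa using hz
  have hcont : ContinuousOn (fun z : ℂ => ∑' m, (binomCoeff α m : ℂ) * z ^ m)
      (Metric.closedBall 0 1) :=
    continuousOn_tsum (fun m => by fun_prop) hsum hbound
  have hcont' : ContinuousOn (fun z : ℂ => (1 - z) ^ (α : ℂ)) (Metric.closedBall 0 1) := by
    intro w hw
    have h1 : ContinuousAt (fun x : ℂ => x ^ (α : ℂ)) (1 - w) := by
      refine Complex.continuousAt_cpow_const_of_re_pos (Or.inl ?_) (by simp; linarith)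
      have := (Complex.re_le_norm w).trans (by simpa using hw)
      simp; linarith
    exact (ContinuousAt.comp (f := fun w : ℂ => 1 - w) h1 (by fun_prop)).continuousWithinAt
  have heq : Set.EqOn (fun z : ℂ => ∑' m, (binomCoeff α m : ℂ) * z ^ m)
      (fun z : ℂ => (1 - z) ^ (α : ℂ)) (Metric.closedBall 0 1) := by
    refine Set.EqOn.of_subset_closure (s := Metric.ball 0 1) (fun w hw => ?_) hcont hcont'
      Metric.ball_subset_closedBall (by rw [closure_ball _ one_ne_zero])
    exact (hasSum_binomCoeff_of_norm_lt α (by simpa using hw)).tsum_eq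
  have hz' := heq hzmem
  simp only at hz'
  rw [← hz']
  exact (Summable.of_norm_bounded hsum fun m => hbound m z hzmem).hasSum

lemma mul_cpow_of_re {a b : ℂ} (ha : a ≠ 0) (ha' : 0 ≤ a.re) (hb : 0 < b.re) (s : ℂ) :
    (a * b) ^ s = a ^ s * b ^ s := by
  have hb0 : b ≠ 0 := by rintro rfl; simp at hb
  have h1 := abs_le.1 (Complex.abs_arg_le_pi_div_two_iff.2 ha')
  have h2 := abs_lt.1 (Complex.abs_arg_lt_pi_div_two_iff.2 (Or.inl hb))
  rw [Complex.cpow_def_of_ne_zero (mul_ne_zero ha hb0), Complex.cpow_def_of_ne_zero ha,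
    Complex.cpow_def_of_ne_zero hb0, Complex.log_mul ha hb0 ⟨by linarith, by linarith⟩,
    ← Complex.exp_add, add_mul]

lemma genBase_eq {α : ℝ} (hα : α ≠ 0) (z : ℂ) :
    genBase α z =
      (1 - z) * ((((3 * α - 2) / (2 * α) : ℝ) : ℂ) + (((2 - α) / (2 * α) : ℝ) : ℂ) * z) := by
  have : (α : ℂ) ≠ 0 := by exact_mod_cast hα
  rw [genBase]
  push_cast
  field_simp
  ring

/-- The factor of `G₄` other than `(1 - z)^α`; for `α > 1` it is holomorphic on a disc of radius
larger than `1`. -/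
def regularFactor (α : ℝ) (z : ℂ) : ℂ :=
  (1 + (eta α : ℂ) * genBase α z ^ 2) *
    ((((3 * α - 2) / (2 * α) : ℝ) : ℂ) + (((2 - α) / (2 * α) : ℝ) : ℂ) * z) ^ (α : ℂ)

lemma linearFactor_re_pos {p q : ℝ} (hq : 0 ≤ q) {z : ℂ} (h : q * ‖z‖ < p) :
    0 < ((p : ℂ) + (q : ℂ) * z).re := by
  have h1 : -‖z‖ ≤ z.re := (abs_le.1 (Complex.abs_re_le_norm z)).1
  have h2 := mul_le_mul_of_nonneg_left h1 hq
  simp only [Complex.add_re, Complex.ofReal_re, Complex.re_ofReal_mul]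
  linarith

lemma linearFactor_coeff_lt {α : ℝ} (hα : 1 < α) :
    (2 - α) / (2 * α) < (3 * α - 2) / (2 * α) := by
  rw [div_lt_div_iff_of_pos_right (by linarith)]
  linarith

lemma G₄_eq {α : ℝ} (hα : 1 < α) (hα' : α ≤ 2) {z : ℂ} (hz : ‖z‖ ≤ 1) :
    G₄ α z = (1 - z) ^ (α : ℂ) * regularFactor α z := by
  rw [G₄, G₂, regularFactor]
  have h0 : (α : ℂ) ≠ 0 := by exact_mod_cast (show α ≠ 0 by linarith)
  rcases eq_or_ne z 1 with rfl | h1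
  · rw [genBase_eq (by linarith)]
    simp [Complex.zero_cpow h0]
  · rw [genBase_eq (α := α) (by linarith) z, mul_cpow_of_re (sub_ne_zero.2 h1.symm)]
    · ring
    · have := (Complex.re_le_norm z).trans hz
      simp; linarith
    · refine linearFactor_re_pos (div_nonneg (by linarith) (by linarith)) ?_
      have h2 : 0 ≤ (2 - α) / (2 * α) := div_nonneg (by linarith) (by linarith)
      exact (mul_le_of_le_one_right h2 hz).trans_lt (linearFactor_coeff_lt hα)

lemma exists_hasSum_regularFactor {α : ℝ} (hα : 1 < α) (hα' : α ≤ 2) :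
    ∃ d : ℕ → ℂ, Summable (fun m => ‖d m‖) ∧
      ∀ z : ℂ, ‖z‖ ≤ 1 → HasSum (fun m => d m * z ^ m) (regularFactor α z) := by
  set p : ℝ := (3 * α - 2) / (2 * α) with hp
  set q : ℝ := (2 - α) / (2 * α) with hq
  have hq0 : 0 ≤ q := div_nonneg (by linarith) (by linarith)
  have hqp : q < p := linearFactor_coeff_lt hα
  have hq1 : q < 1 := by
    rw [hq, div_lt_one (by linarith)]
    linarith
  have hpR : 0 ≤ 1 + (p - q) / 2 := by linarith
  -- `q < 1` and `q < p` give `q R < p`, so the base of the power stays off the cut for `‖z‖ ≤ R`.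
  set R : NNReal := ⟨1 + (p - q) / 2, hpR⟩ with hR
  have hRv : (R : ℝ) = 1 + (p - q) / 2 := rfl
  have hdiff : DifferentiableOn ℂ (regularFactor α) (Metric.closedBall 0 R) := by
    intro z hz
    have hz' : ‖z‖ ≤ 1 + (p - q) / 2 := by simpa [hRv] using hz
    have hre : 0 < ((p : ℂ) + (q : ℂ) * z).re := by
      refine linearFactor_re_pos hq0 ?_
      have := mul_le_mul_of_nonneg_left hz' hq0
      nlinarith
    refine DifferentiableAt.differentiableWithinAt ?_
    unfold regularFactor genBase
    refine DifferentiableAt.mul (by fun_prop) ?_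
    exact DifferentiableAt.cpow_const (by fun_prop) (Or.inl hre)
  have h1R : (1 : NNReal) < R := by
    rw [← NNReal.coe_lt_coe, hRv, NNReal.coe_one]
    linarith
  have hps := hdiff.hasFPowerSeriesOnBall (zero_lt_one.trans h1R)
  refine ⟨(cauchyPowerSeries (regularFactor α) 0 R).coeff, ?_, fun z hz => ?_⟩
  · have h := (cauchyPowerSeries (regularFactor α) 0 R).summable_norm_mul_pow (r := 1)
      (lt_of_lt_of_le (by exact_mod_cast h1R) hps.r_le)
    simpa [FormalMultilinearSeries.norm_apply_eq_norm_coef] using h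
  · have hmem : z ∈ Metric.eball (0 : ℂ) R := by
      rw [Metric.eball_coe]
      have : ‖z‖ < R := lt_of_le_of_lt hz (by exact_mod_cast h1R)
      simpa using this
    have h := hps.hasSum hmem
    rw [zero_add] at h
    refine h.congr_fun fun m => ?_
    rw [FormalMultilinearSeries.apply_eq_pow_smul_coeff, smul_eq_mul, mul_comm]

/-- Cauchy products of absolutely convergent power series on the closed unit disc. -/
lemma exists_hasSum_mul {f g : ℂ → ℂ} {b d : ℕ → ℂ} (hb : Summable fun m => ‖b m‖)
    (hd : Summable fun m => ‖d m‖)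
    (hf : ∀ z : ℂ, ‖z‖ ≤ 1 → HasSum (fun m => b m * z ^ m) (f z))
    (hg : ∀ z : ℂ, ‖z‖ ≤ 1 → HasSum (fun m => d m * z ^ m) (g z)) :
    ∃ c : ℕ → ℂ, Summable (fun m => ‖c m‖) ∧
      ∀ z : ℂ, ‖z‖ ≤ 1 → HasSum (fun m => c m * z ^ m) (f z * g z) := by
  have hle : ∀ (e : ℕ → ℂ) (z : ℂ), ‖z‖ ≤ 1 → Summable (fun m => ‖e m‖) →
      Summable fun m => ‖e m * z ^ m‖ := by
    intro e z hz he
    refine Summable.of_nonneg_of_le (fun _ => norm_nonneg _) (fun m => ?_) he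
    rw [norm_mul, norm_pow]
    exact mul_le_of_le_one_right (norm_nonneg _) (pow_le_one₀ (norm_nonneg _) hz)
  have hc := summable_norm_sum_mul_antidiagonal_of_summable_norm hb hd
  refine ⟨_, hc, fun z hz => ?_⟩
  rw [← (hf z hz).tsum_eq, ← (hg z hz).tsum_eq,
    tsum_mul_tsum_eq_tsum_sum_antidiagonal_of_summable_norm (hle b z hz hb) (hle d z hz hd)]
  have heq : ∀ m, (∑ kl ∈ Finset.HasAntidiagonal.antidiagonal m, b kl.1 * d kl.2) * z ^ m =
      ∑ kl ∈ Finset.HasAntidiagonal.antidiagonal m, b kl.1 * z ^ kl.1 * (d kl.2 * z ^ kl.2) := by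
    intro m
    rw [Finset.sum_mul]
    refine Finset.sum_congr rfl fun kl hkl => ?_
    rw [← Finset.HasAntidiagonal.mem_antidiagonal.1 hkl, pow_add]
    ring
  simp only [← heq]
  exact (hle _ z hz hc).of_norm.hasSum

lemma exists_hasSum_G₄ {α : ℝ} (hα : 1 < α) (hα' : α ≤ 2) :
    ∃ c : ℕ → ℂ, Summable (fun m => ‖c m‖) ∧
      ∀ z : ℂ, ‖z‖ ≤ 1 → HasSum (fun m => c m * z ^ m) (G₄ α z) := by
  obtain ⟨d, hd, hd'⟩ := exists_hasSum_regularFactor hα hα'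
  obtain ⟨c, hc, hc'⟩ := exists_hasSum_mul (b := fun m => (binomCoeff α m : ℂ))
    (f := fun z => (1 - z) ^ (α : ℂ)) (by simpa using summable_abs_binomCoeff hα hα') hd
    (fun z hz => hasSum_binomCoeff hα hα' hz) hd'
  refine ⟨c, hc, fun z hz => ?_⟩
  rw [G₄_eq hα hα' hz]
  exact hc' z hz

lemma kappa₄_eq_of_hasSum {α : ℝ} {c : ℕ → ℂ}
    (h : ∀ z : ℂ, ‖z‖ ≤ 1 → HasSum (fun m => c m * z ^ m) (G₄ α z)) (m : ℕ) : kappa₄ α m = c m := by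
  refine iteratedDeriv_div_factorial_eq ?_ m
  filter_upwards [Metric.closedBall_mem_nhds (0 : ℂ) one_pos] with z hz
  exact h z (by simpa using hz)

lemma summable_norm_kappa₄ {α : ℝ} (hα : 1 < α) (hα' : α ≤ 2) :
    Summable (fun m => ‖kappa₄ α m‖) := by
  obtain ⟨c, hc, hc'⟩ := exists_hasSum_G₄ hα hα'
  simpa only [kappa₄_eq_of_hasSum hc'] using hc

/-- The Taylor series of `G₄` converges absolutely to `G₄` on the closed unit disc. -/
lemma hasSum_kappa₄ {α : ℝ} (hα : 1 < α) (hα' : α ≤ 2) {z : ℂ} (hz : ‖z‖ ≤ 1) :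
    HasSum (fun m => kappa₄ α m * z ^ m) (G₄ α z) := by
  obtain ⟨c, hc, hc'⟩ := exists_hasSum_G₄ hα hα'
  simpa only [kappa₄_eq_of_hasSum hc'] using hc' z hz

lemma norm_G₄_le {α : ℝ} (hα : 1 < α) (hα' : α ≤ 2) {z : ℂ} (hz : ‖z‖ ≤ 1) :
    ‖G₄ α z‖ ≤ ∑' m, ‖kappa₄ α m‖ := by
  refine (hasSum_kappa₄ hα hα' hz).norm_le_of_bounded (summable_norm_kappa₄ hα hα').hasSum
    fun m => ?_
  rw [norm_mul, norm_pow]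
  exact mul_le_of_le_one_right (norm_nonneg _) (pow_le_one₀ (norm_nonneg _) hz)

/-! ### Third-order jets at the origin -/

/-- `F(z) = p₀ + p₁ z + p₂ z² + p₃ z³ + O(z⁴)` as `z → 0`, `z ≠ 0`. The value at `0` is ignored, so
that removable singularities need no care. -/
def HasJet (F : ℂ → ℂ) (p₀ p₁ p₂ p₃ : ℂ) : Prop :=
  (fun z => F z - (p₀ + p₁ * z + p₂ * z ^ 2 + p₃ * z ^ 3)) =O[𝓝[≠] 0] fun z => z ^ 4

lemma HasJet.congr {F G : ℂ → ℂ} {p₀ p₁ p₂ p₃ : ℂ} (h : HasJet F p₀ p₁ p₂ p₃)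
    (hFG : F =ᶠ[𝓝[≠] 0] G) : HasJet G p₀ p₁ p₂ p₃ :=
  Asymptotics.IsBigO.congr' h (hFG.mono fun z hz => by simp only [hz]) EventuallyEq.rfl

lemma HasJet.congr_coeff {F : ℂ → ℂ} {p₀ p₁ p₂ p₃ q₀ q₁ q₂ q₃ : ℂ} (h : HasJet F p₀ p₁ p₂ p₃)
    (h₀ : p₀ = q₀) (h₁ : p₁ = q₁) (h₂ : p₂ = q₂) (h₃ : p₃ = q₃) : HasJet F q₀ q₁ q₂ q₃ := by
  rwa [← h₀, ← h₁, ← h₂, ← h₃]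

lemma hasJet_poly (p₀ p₁ p₂ p₃ : ℂ) :
    HasJet (fun z => p₀ + p₁ * z + p₂ * z ^ 2 + p₃ * z ^ 3) p₀ p₁ p₂ p₃ := by
  simp only [HasJet, sub_self]
  exact Asymptotics.isBigO_zero _ _

lemma hasJet_const (c : ℂ) : HasJet (fun _ => c) c 0 0 0 := by
  simpa using hasJet_poly c 0 0 0

lemma hasJet_id : HasJet (fun z => z) 0 1 0 0 := by
  simpa using hasJet_poly 0 1 0 0

lemma HasJet.add {F G : ℂ → ℂ} {p₀ p₁ p₂ p₃ q₀ q₁ q₂ q₃ : ℂ} (hF : HasJet F p₀ p₁ p₂ p₃)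
    (hG : HasJet G q₀ q₁ q₂ q₃) :
    HasJet (fun z => F z + G z) (p₀ + q₀) (p₁ + q₁) (p₂ + q₂) (p₃ + q₃) := by
  refine (Asymptotics.IsBigO.add hF hG).congr_left fun z => ?_
  ring

lemma isBigO_one_of_continuous {F : ℂ → ℂ} (hF : Continuous F) :
    F =O[𝓝[≠] 0] fun _ => (1 : ℂ) :=
  ((hF.tendsto 0).mono_left nhdsWithin_le_nhds).isBigO_one ℂ

lemma isBigO_pow_of_le {m n : ℕ} (h : n ≤ m) :
    (fun z : ℂ => z ^ m) =O[𝓝[≠] 0] fun z => z ^ n := by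
  have := (isBigO_one_of_continuous (continuous_pow (M := ℂ) (m - n))).mul
    (Asymptotics.isBigO_refl (fun z : ℂ => z ^ n) (𝓝[≠] 0))
  simpa [← pow_add, Nat.sub_add_cancel h] using this

lemma HasJet.isBigO_one {F : ℂ → ℂ} {p₀ p₁ p₂ p₃ : ℂ} (hF : HasJet F p₀ p₁ p₂ p₃) :
    F =O[𝓝[≠] 0] fun _ => (1 : ℂ) := by
  have h1 : (fun z : ℂ => z ^ 4) =O[𝓝[≠] 0] fun _ => (1 : ℂ) :=
    isBigO_one_of_continuous (continuous_pow 4)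
  have h2 : (fun z : ℂ => p₀ + p₁ * z + p₂ * z ^ 2 + p₃ * z ^ 3) =O[𝓝[≠] 0] fun _ => (1 : ℂ) :=
    isBigO_one_of_continuous (by fun_prop)
  simpa using (Asymptotics.IsBigO.trans hF h1).add h2

lemma HasJet.isBigO_id {F : ℂ → ℂ} {p₁ p₂ p₃ : ℂ} (hF : HasJet F 0 p₁ p₂ p₃) :
    F =O[𝓝[≠] 0] fun z => z := by
  have h1 : (fun z : ℂ => z ^ 4) =O[𝓝[≠] 0] fun z => z := by
    simpa using isBigO_pow_of_le (m := 4) (n := 1) (by norm_num)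
  have h2 : (fun z : ℂ => (p₁ + p₂ * z + p₃ * z ^ 2) * z) =O[𝓝[≠] 0] fun z => 1 * z :=
    (isBigO_one_of_continuous (by fun_prop)).mul (Asymptotics.isBigO_refl _ _)
  simp only [one_mul] at h2
  refine ((Asymptotics.IsBigO.trans hF h1).add h2).congr_left fun z => ?_
  ring

lemma HasJet.mul {F G : ℂ → ℂ} {p₀ p₁ p₂ p₃ q₀ q₁ q₂ q₃ : ℂ} (hF : HasJet F p₀ p₁ p₂ p₃)
    (hG : HasJet G q₀ q₁ q₂ q₃) :
    HasJet (fun z => F z * G z) (p₀ * q₀) (p₀ * q₁ + p₁ * q₀) (p₀ * q₂ + p₁ * q₁ + p₂ * q₀)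
      (p₀ * q₃ + p₁ * q₂ + p₂ * q₁ + p₃ * q₀) := by
  have h1 := hF.isBigO_one.mul hG
  have h2 := Asymptotics.IsBigO.mul hF
    (isBigO_one_of_continuous (F := fun z => q₀ + q₁ * z + q₂ * z ^ 2 + q₃ * z ^ 3) (by fun_prop))
  have h3 := (isBigO_one_of_continuous (F := fun z => (p₁ * q₃ + p₂ * q₂ + p₃ * q₁) +
    (p₂ * q₃ + p₃ * q₂) * z + p₃ * q₃ * z ^ 2) (by fun_prop)).mul
    (Asymptotics.isBigO_refl (fun z : ℂ => z ^ 4) (𝓝[≠] 0))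
  simp only [one_mul, mul_one] at h1 h2 h3
  refine ((h1.add h2).add h3).congr_left fun z => ?_
  ring

lemma HasJet.const_mul {F : ℂ → ℂ} {p₀ p₁ p₂ p₃ : ℂ} (c : ℂ) (hF : HasJet F p₀ p₁ p₂ p₃) :
    HasJet (fun z => c * F z) (c * p₀) (c * p₁) (c * p₂) (c * p₃) := by
  simpa using (hasJet_const c).mul hF

/-- Substitution of a jet without constant term into a function with a known Taylor polynomial. -/
lemma HasJet.comp {Φ w : ℂ → ℂ} {c₀ c₁ c₂ c₃ a b c : ℂ}
    (hΦ : (fun z => Φ z - (c₀ + c₁ * z + c₂ * z ^ 2 + c₃ * z ^ 3)) =O[𝓝 0] fun z => z ^ 4)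
    (hw : HasJet w 0 a b c) :
    HasJet (fun z => Φ (w z)) c₀ (c₁ * a) (c₁ * b + c₂ * a ^ 2)
      (c₁ * c + 2 * c₂ * a * b + c₃ * a ^ 3) := by
  have hw0 : Tendsto w (𝓝[≠] 0) (𝓝 0) :=
    hw.isBigO_id.trans_tendsto (tendsto_id.mono_left nhdsWithin_le_nhds)
  have h1 : (fun z => Φ (w z) - (c₀ + c₁ * w z + c₂ * w z ^ 2 + c₃ * w z ^ 3))
      =O[𝓝[≠] 0] fun z => z ^ 4 :=
    (hΦ.comp_tendsto hw0).trans (hw.isBigO_id.pow 4)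
  have h2 := (((hasJet_const c₀).add (hw.const_mul c₁)).add ((hw.mul hw).const_mul c₂)).add
    (((hw.mul hw).mul hw).const_mul c₃)
  refine (Asymptotics.IsBigO.add h1 h2).congr_left fun z => ?_
  ring

lemma HasJet.cexp {w : ℂ → ℂ} {a b c : ℂ} (hw : HasJet w 0 a b c) :
    HasJet (fun z => Complex.exp (w z)) 1 a (b + a ^ 2 / 2) (c + a * b + a ^ 3 / 6) := by
  have h := Complex.exp_sub_sum_range_isBigO_pow 4
  refine (HasJet.comp (Φ := Complex.exp) (c₀ := 1) (c₁ := 1) (c₂ := 1 / 2) (c₃ := 1 / 6) ?_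
    hw).congr_coeff rfl ?_ ?_ ?_
  · refine h.congr_left fun z => ?_
    simp [Finset.sum_range_succ, Nat.factorial]
    ring
  all_goals ring

lemma HasJet.clog_one_add {w : ℂ → ℂ} {a b c : ℂ} (hw : HasJet w 0 a b c) :
    HasJet (fun z => Complex.log (1 + w z)) 0 a (b - a ^ 2 / 2) (c - a * b + a ^ 3 / 3) := by
  have h := Complex.log_sub_logTaylor_isBigO 3
  refine (HasJet.comp (Φ := fun z => Complex.log (1 + z)) (c₀ := 0) (c₁ := 1) (c₂ := -1 / 2)
    (c₃ := 1 / 3) ?_ hw).congr_coeff rfl ?_ ?_ ?_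
  · refine h.congr_left fun z => ?_
    simp [Complex.logTaylor, Finset.sum_range_succ]
    ring
  all_goals ring

/-- The second Taylor coefficient of an analytic function can be read off its jet. -/
lemma HasJet.iteratedDeriv_two {F : ℂ → ℂ} {p₀ p₁ p₂ p₃ : ℂ} (hF : AnalyticAt ℂ F 0)
    (h : HasJet F p₀ p₁ p₂ p₃) : iteratedDeriv 2 F 0 = 2 * p₂ := by
  set P : ℂ → ℂ := fun z => p₀ + p₁ * z + p₂ * z ^ 2 + p₃ * z ^ 3 with hP
  have hPa : AnalyticAt ℂ P 0 := by
    refine Differentiable.analyticAt ?_ 0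
    fun_prop
  have hD : AnalyticAt ℂ (fun z => F z - P z) 0 := hF.sub hPa
  have horder : (3 : ℕ) ≤ analyticOrderAt (fun z => F z - P z) 0 := by
    by_contra hlt
    push Not at hlt
    obtain ⟨n, hn⟩ := ENat.ne_top_iff_exists.1 (ne_top_of_lt hlt)
    rw [← hn] at hlt
    have hn3 : n < 3 := by exact_mod_cast hlt
    obtain ⟨g, hg, hg0, hgD⟩ := (hD.analyticOrderAt_eq_natCast).1 hn.symm
    obtain ⟨C, hC⟩ := Asymptotics.IsBigO.bound h
    have hle : ∀ᶠ z in 𝓝[≠] (0 : ℂ), ‖g z‖ ≤ C * ‖z‖ ^ (4 - n) := by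
      filter_upwards [hC, nhdsWithin_le_nhds hgD, self_mem_nhdsWithin] with z h1 h2 h3
      have h3' : 0 < ‖z‖ := norm_pos_iff.2 h3
      have h4 : ‖z‖ ^ n * ‖g z‖ ≤ ‖z‖ ^ n * (C * ‖z‖ ^ (4 - n)) := by
        calc ‖z‖ ^ n * ‖g z‖ = ‖F z - P z‖ := by rw [h2, sub_zero, norm_smul, norm_pow]
          _ ≤ C * ‖z ^ 4‖ := h1
          _ = ‖z‖ ^ n * (C * ‖z‖ ^ (4 - n)) := by
            rw [norm_pow, mul_left_comm, ← pow_add, Nat.add_sub_cancel' (by omega)]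
      exact le_of_mul_le_mul_left h4 (by positivity)
    have ht : Tendsto (fun z : ℂ => C * ‖z‖ ^ (4 - n)) (𝓝[≠] 0) (𝓝 0) := by
      have hc : Continuous (fun z : ℂ => C * ‖z‖ ^ (4 - n)) := by fun_prop
      refine (hc.tendsto' 0 0 ?_).mono_left nhdsWithin_le_nhds
      rw [norm_zero, zero_pow (by omega), mul_zero]
    have ht' : Tendsto (fun z => ‖g z‖) (𝓝[≠] 0) (𝓝 ‖g 0‖) :=
      (hg.continuousAt.norm.tendsto).mono_left nhdsWithin_le_nhds
    have := le_of_tendsto_of_tendsto ht' ht hle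
    exact hg0 (norm_le_zero_iff.1 this)
  have h0 := (natCast_le_analyticOrderAt_iff_iteratedDeriv_eq_zero hD).1 horder 2 (by norm_num)
  have h1 : iteratedDeriv 2 (fun z => F z - P z) 0 = iteratedDeriv 2 F 0 - iteratedDeriv 2 P 0 :=
    iteratedDeriv_fun_sub (hF.contDiffAt) (hPa.contDiffAt)
  have h2 : iteratedDeriv 2 P 0 = 2 * p₂ := by
    have hd : deriv P = fun z => p₁ + 2 * p₂ * z + 3 * p₃ * z ^ 2 := by
      ext z
      have : HasDerivAt P
          (p₁ * 1 + p₂ * ((2 : ℕ) * z ^ (2 - 1)) + p₃ * ((3 : ℕ) * z ^ (3 - 1))) z :=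
        ((((hasDerivAt_id z).const_mul p₁).const_add p₀).add
          ((hasDerivAt_pow 2 z).const_mul p₂)).add ((hasDerivAt_pow 3 z).const_mul p₃)
      rw [this.deriv]; push_cast; ring
    rw [iteratedDeriv_succ, iteratedDeriv_one, hd]
    have : HasDerivAt (fun z : ℂ => p₁ + 2 * p₂ * z + 3 * p₃ * z ^ 2)
        (2 * p₂ * 1 + 3 * p₃ * ((2 : ℕ) * 0 ^ (2 - 1))) 0 :=
      (((hasDerivAt_id (0 : ℂ)).const_mul (2 * p₂)).const_add p₁).add
        ((hasDerivAt_pow 2 (0 : ℂ)).const_mul (3 * p₃))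
    rw [this.deriv]; simp
  rw [← h2, ← sub_eq_zero, ← h1, h0]

/-! ### The symbol at low frequency -/

/-- The holomorphic extension of `(e^{-z} - 1) / z`. -/
def expSlope : ℂ → ℂ := dslope (fun z : ℂ => Complex.exp (-z)) 0

lemma exp_neg_eq (z : ℂ) : Complex.exp (-z) = 1 + z * expSlope z := by
  have h := sub_smul_dslope (fun z : ℂ => Complex.exp (-z)) 0 z
  simp only [sub_zero, smul_eq_mul, neg_zero, Complex.exp_zero] at h
  rw [expSlope, h]; ring

lemma analyticAt_expSlope : AnalyticAt ℂ expSlope 0 := by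
  have h : AnalyticAt ℂ (fun z : ℂ => Complex.exp (-z)) 0 :=
    Differentiable.analyticAt (by fun_prop) 0
  exact h.hasFPowerSeriesAt.has_fpower_series_dslope_fslope.analyticAt

lemma expSlope_zero : expSlope 0 = -1 := by
  rw [expSlope, dslope_same]
  have : HasDerivAt (fun z : ℂ => Complex.exp (-z)) (Complex.exp (-0) * -1) 0 :=
    (hasDerivAt_neg (0 : ℂ)).cexp
  rw [this.deriv]; simp

lemma hasJet_expSlope : HasJet expSlope (-1) (1 / 2) (-1 / 6) (1 / 24) := by
  have h := (Complex.exp_sub_sum_range_isBigO_pow 5).comp_tendsto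
    (k := fun z : ℂ => -z) (l' := 𝓝[≠] 0)
    ((continuous_neg.tendsto' (0 : ℂ) 0 neg_zero).mono_left nhdsWithin_le_nhds)
  obtain ⟨C, hC⟩ := h.bound
  refine Asymptotics.IsBigO.of_bound C ?_
  filter_upwards [hC, self_mem_nhdsWithin] with z h1 h3
  have h3' : 0 < ‖z‖ := norm_pos_iff.2 h3
  simp only [Function.comp, exp_neg_eq] at h1
  have h2 : 1 + z * expSlope z - ∑ i ∈ Finset.range 5, (-z) ^ i / (i ! : ℂ) =
      z * (expSlope z - (-1 + 1 / 2 * z + -1 / 6 * z ^ 2 + 1 / 24 * z ^ 3)) := by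
    simp [Finset.sum_range_succ, Nat.factorial]
    ring
  rw [h2, norm_mul, norm_pow, norm_neg] at h1
  rw [norm_pow]
  refine le_of_mul_le_mul_left (h1.trans_eq ?_) h3'
  ring

/-- The holomorphic function `g` with `P(e^{-z}) = z g(z)`, where `P` is the quadratic polynomial
`genBase α`. -/
def baseSlope (α : ℝ) (z : ℂ) : ℂ :=
  -expSlope z + (((α - 2) / (2 * α) : ℝ) : ℂ) * (z * (expSlope z * expSlope z))

lemma genBase_exp {α : ℝ} (hα : α ≠ 0) (z : ℂ) :
    genBase α (Complex.exp (-z)) = z * baseSlope α z := by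
  have : (α : ℂ) ≠ 0 := by exact_mod_cast hα
  rw [genBase, exp_neg_eq, baseSlope]
  push_cast
  field_simp
  ring

lemma analyticAt_baseSlope (α : ℝ) : AnalyticAt ℂ (baseSlope α) 0 :=
  analyticAt_expSlope.neg.add (analyticAt_const.mul
    (analyticAt_id.mul (analyticAt_expSlope.mul analyticAt_expSlope)))

lemma baseSlope_zero (α : ℝ) : baseSlope α 0 = 1 := by
  simp [baseSlope, expSlope_zero]

lemma hasJet_baseSlope {α : ℝ} (hα : α ≠ 0) :
    HasJet (baseSlope α) 1 (-1 / α) ((3 - α) / (3 * α)) ((3 * α - 7) / (12 * α)) := by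
  have hα' : (α : ℂ) ≠ 0 := by exact_mod_cast hα
  have h := (hasJet_expSlope.const_mul (-1)).add ((hasJet_id.mul
    (hasJet_expSlope.mul hasJet_expSlope)).const_mul (((α - 2) / (2 * α) : ℝ) : ℂ))
  refine (h.congr (Eventually.of_forall fun z => ?_)).congr_coeff ?_ ?_ ?_ ?_
  · simp [baseSlope]
  all_goals
    push_cast
    field_simp
    ring

/-- The symbol `e^z z^{-α} G₄(e^{-z})` in a form that is visibly holomorphic at `0`. -/
def regularSymbol (α : ℝ) (z : ℂ) : ℂ :=
  Complex.exp (z + α * Complex.log (1 + (baseSlope α z - 1))) *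
    (1 + (eta α : ℂ) * ((z * baseSlope α z) * (z * baseSlope α z)))

lemma analyticAt_regularSymbol (α : ℝ) : AnalyticAt ℂ (regularSymbol α) 0 := by
  have hg := analyticAt_baseSlope α
  have hz := (analyticAt_id (𝕜 := ℂ) (z := (0 : ℂ))).mul hg
  refine AnalyticAt.mul (AnalyticAt.cexp (analyticAt_id.add (analyticAt_const.mul
    (AnalyticAt.clog (analyticAt_const.add (hg.sub analyticAt_const)) ?_))))
    (analyticAt_const.add (analyticAt_const.mul (hz.mul hz)))
  simp [baseSlope_zero]

/-- The first and third order terms of the symbol cancel; `η` is chosen for this. -/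
lemma hasJet_regularSymbol {α : ℝ} (hα : α ≠ 0) :
    HasJet (regularSymbol α) 1 0
      (((3 * α ^ 3 - 19 * α ^ 2 + 36 * α - 16) / (24 * α) : ℝ) : ℂ) 0 := by
  have hα' : (α : ℂ) ≠ 0 := by exact_mod_cast hα
  have hg := hasJet_baseSlope hα
  have hw : HasJet (fun z => baseSlope α z - 1) 0 (-1 / α) ((3 - α) / (3 * α))
      ((3 * α - 7) / (12 * α)) := by
    refine ((hg.add (hasJet_const (-1))).congr (Eventually.of_forall fun z => ?_)).congr_coeff
      ?_ ?_ ?_ ?_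
    · simp [sub_eq_add_neg]
    all_goals ring
  have hE := (hasJet_id.add (hw.clog_one_add.const_mul (α : ℂ))).congr_coeff (q₀ := 0) (by ring)
    rfl rfl rfl
  have hf := hasJet_id.mul hg
  have h := hE.cexp.mul ((hasJet_const 1).add ((hf.mul hf).const_mul (eta α : ℂ)))
  refine (h.congr (Eventually.of_forall fun z => ?_)).congr_coeff ?_ ?_ ?_ ?_
  · simp [regularSymbol]
  all_goals
    simp only [eta]
    push_cast
    field_simp
    ring

/-! ### Branches of the power -/

lemma genBase_conj (α : ℝ) (z : ℂ) :
    genBase α ((starRingEnd ℂ) z) = (starRingEnd ℂ) (genBase α z) := by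
  simp only [genBase, map_add, map_mul, map_pow, Complex.conj_ofReal]

/-- Near `0` the function `P(e^{-z})` has real coefficients and derivative `1`, so it maps the upper
and lower half-planes into themselves. -/
lemma eventually_im_mul_baseSlope {α : ℝ} (hα : α ≠ 0) :
    ∀ᶠ z in 𝓝 (0 : ℂ), |(z * baseSlope α z).im - z.im| ≤ 1 / 2 * |z.im| := by
  set f : ℂ → ℂ := fun z => z * baseSlope α z with hf
  have hfa : AnalyticAt ℂ f 0 := analyticAt_id.mul (analyticAt_baseSlope α)
  have hd : deriv f 0 = 1 := by
    have := (hasDerivAt_id (0 : ℂ)).mul (analyticAt_baseSlope α).differentiableAt.hasDerivAt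
    have h2 : HasDerivAt f 1 0 := by
      refine this.congr_deriv ?_
      simp [baseSlope_zero]
    exact h2.deriv
  have hs := hfa.hasStrictDerivAt
  rw [hd, hasStrictDerivAt_iff_hasStrictFDerivAt] at hs
  have ho := hs.isLittleO.bound (show (0 : ℝ) < 1 / 2 by norm_num)
  have ht : Tendsto (fun z : ℂ => (z, (starRingEnd ℂ) z)) (𝓝 0) (𝓝 ((0 : ℂ), (0 : ℂ))) := by
    have : Continuous (fun z : ℂ => (z, (starRingEnd ℂ) z)) :=
      continuous_id.prodMk Complex.continuous_conj
    exact this.tendsto' _ _ (by simp)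
  filter_upwards [ht.eventually ho] with z hz
  -- Comparing `z` with its conjugate turns strict differentiability into a bound on `Im f`.
  have hconj : f ((starRingEnd ℂ) z) = (starRingEnd ℂ) (f z) := by
    simp only [hf]
    rw [← genBase_exp hα, ← genBase_exp hα, ← genBase_conj, ← Complex.exp_conj, map_neg]
  simp only [hconj, Complex.sub_conj, ContinuousLinearMap.toSpanSingleton_apply, smul_eq_mul,
    mul_one] at hz
  rw [← sub_mul, norm_mul, norm_mul, Complex.norm_I, mul_one, mul_one, ← Complex.ofReal_sub,
    Complex.norm_real, Complex.norm_real, Real.norm_eq_abs, Real.norm_eq_abs, ← mul_sub, abs_mul,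
    abs_mul] at hz
  norm_num at hz
  change |(f z).im - z.im| ≤ _
  linarith

/-- The principal branches of `P(e^{-z})^α` and `z^α` match near `0`, including across the cut. -/
lemma eventually_mul_cpow_baseSlope {α : ℝ} (hα : α ≠ 0) (s : ℂ) :
    ∀ᶠ z in 𝓝[≠] (0 : ℂ), (z * baseSlope α z) ^ s = z ^ s * baseSlope α z ^ s := by
  have hre : ∀ᶠ z in 𝓝 (0 : ℂ), 0 < (baseSlope α z).re := by
    have hc : ContinuousAt (fun z => (baseSlope α z).re) 0 :=
      Complex.continuous_re.continuousAt.comp (analyticAt_baseSlope α).continuousAt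
    refine hc.eventually (lt_mem_nhds ?_)
    simp [baseSlope_zero]
  filter_upwards [nhdsWithin_le_nhds hre, nhdsWithin_le_nhds (eventually_im_mul_baseSlope hα),
    self_mem_nhdsWithin] with z h1 h2 h0
  set g := baseSlope α z with hg
  have hg0 : g ≠ 0 := by intro h; rw [h] at h1; simp at h1
  have ha := abs_lt.1 (Complex.abs_arg_lt_pi_div_two_iff.2 (Or.inl h1))
  have hb1 := Complex.neg_pi_lt_arg z
  have hb2 := Complex.arg_le_pi z
  have him : (z * g).im = ‖z‖ * ‖g‖ * Real.sin (z.arg + g.arg) := by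
    rw [Complex.mul_im, ← Complex.norm_mul_cos_arg z, ← Complex.norm_mul_sin_arg z,
      ← Complex.norm_mul_cos_arg g, ← Complex.norm_mul_sin_arg g, Real.sin_add]
    ring
  have hpos : 0 < ‖z‖ * ‖g‖ := mul_pos (norm_pos_iff.2 h0) (norm_pos_iff.2 hg0)
  -- If the arguments added up beyond the cut, the sine would give `Im (z g)` the wrong sign.
  have hsum : z.arg + g.arg ∈ Set.Ioc (-Real.pi) Real.pi := by
    rw [abs_le] at h2
    constructor
    · by_contra hle
      push Not at hle
      have hz : z.im < 0 := Complex.arg_neg_iff.1 (by linarith [Real.pi_pos])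
      rw [abs_of_neg hz] at h2
      have hs : 0 ≤ Real.sin (z.arg + g.arg) := by
        rw [← Real.sin_add_two_pi]
        exact Real.sin_nonneg_of_nonneg_of_le_pi (by linarith) (by linarith)
      have := mul_nonneg hpos.le hs
      linarith
    · by_contra hle
      push Not at hle
      have hz : 0 ≤ z.im := Complex.arg_nonneg_iff.1 (by linarith [Real.pi_pos])
      rw [abs_of_nonneg hz] at h2
      have hs : Real.sin (z.arg + g.arg) < 0 := by
        rw [← Real.sin_sub_two_pi]
        exact Real.sin_neg_of_neg_of_neg_pi_lt (by linarith) (by linarith)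
      have := mul_neg_of_pos_of_neg hpos hs
      linarith
  rw [Complex.cpow_def_of_ne_zero (mul_ne_zero h0 hg0), Complex.cpow_def_of_ne_zero h0,
    Complex.cpow_def_of_ne_zero hg0, Complex.log_mul h0 hg0 hsum, ← Complex.exp_add, add_mul]

lemma symbolFun_of_ne_zero (α : ℝ) {z : ℂ} (hz : z ≠ 0) :
    symbolFun α z = Complex.exp z / z ^ (α : ℂ) * G₄ α (Complex.exp (-z)) := by
  rw [symbolFun, Function.update_of_ne hz]

lemma symbolFun_eventuallyEq {α : ℝ} (hα : α ≠ 0) :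
    symbolFun α =ᶠ[𝓝 0] regularSymbol α := by
  have h : ∀ᶠ z in 𝓝[≠] (0 : ℂ), symbolFun α z = regularSymbol α z := by
    have hne : ∀ᶠ z in 𝓝 (0 : ℂ), baseSlope α z ≠ 0 :=
      (analyticAt_baseSlope α).continuousAt.eventually_ne (by simp [baseSlope_zero])
    filter_upwards [eventually_mul_cpow_baseSlope hα α, nhdsWithin_le_nhds hne,
      self_mem_nhdsWithin] with z h1 h2 h0
    have hz : z ^ (α : ℂ) ≠ 0 := by
      rw [Complex.cpow_def_of_ne_zero h0]; exact Complex.exp_ne_zero _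
    rw [symbolFun_of_ne_zero α h0, G₄, G₂, genBase_exp hα, h1, regularSymbol, add_sub_cancel,
      Complex.exp_add, Complex.cpow_def_of_ne_zero h2, mul_comm (α : ℂ)]
    field_simp
  have h' := eventually_nhdsWithin_iff.1 h
  filter_upwards [h'] with z hz
  rcases eq_or_ne z 0 with rfl | h0
  · simp [symbolFun, regularSymbol, baseSlope_zero]
  · exact hz h0

/-- The value of the coefficient `ϱ₂`. -/
lemma varrho_two {α : ℝ} (hα : α ≠ 0) :
    varrho α 2 = (((3 * α ^ 3 - 19 * α ^ 2 + 36 * α - 16) / (24 * α) : ℝ) : ℂ) := by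
  rw [varrho, (symbolFun_eventuallyEq hα).iteratedDeriv_eq 2,
    (hasJet_regularSymbol hα).iteratedDeriv_two (analyticAt_regularSymbol α)]
  simp [Nat.factorial]

/-! ### The symbol of the consistency error -/

/-- `z^α (1 + ϱ₂ (e^z - 2 + e^{-z})) - e^z G₄(e^{-z})`; at `z = iξh` this is `h^α` times the symbol
of the difference between the compact operator applied to the derivative and the difference
operator. -/
def errorSymbol (α : ℝ) (z : ℂ) : ℂ :=
  z ^ (α : ℂ) * (1 + varrho α 2 * (Complex.exp z - 2 + Complex.exp (-z))) -
    Complex.exp z * G₄ α (Complex.exp (-z))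

lemma isBigO_compactSymbol_sub_symbolFun {α : ℝ} (hα : α ≠ 0) :
    (fun z => 1 + varrho α 2 * (Complex.exp z - 2 + Complex.exp (-z)) - symbolFun α z)
      =O[𝓝[≠] 0] fun z => z ^ 4 := by
  have h1 := hasJet_id.cexp
  have h2 := (hasJet_id.const_mul (-1)).congr_coeff (q₀ := 0) (by ring) rfl rfl rfl |>.cexp
  have h3 := (hasJet_const 1).add (((h1.add (hasJet_const (-2))).add h2).const_mul (varrho α 2))
  have h4 := (hasJet_regularSymbol hα).congr
    ((symbolFun_eventuallyEq hα).symm.filter_mono nhdsWithin_le_nhds)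
  have h5 := h3.add (h4.const_mul (-1))
  have h6 : HasJet (fun z => 1 + varrho α 2 * (Complex.exp z - 2 + Complex.exp (-z)) -
      symbolFun α z) 0 0 0 0 := by
    refine (h5.congr (Eventually.of_forall fun z => ?_)).congr_coeff ?_ ?_ ?_ ?_
    · simp [sub_eq_add_neg]
    · ring
    · ring
    · rw [varrho_two hα]; ring
    · ring
  simpa [HasJet] using h6

/-- The consistency error is of order `|θ|^{4+α}` at all frequencies: near `0` by the Taylor
expansion of the symbol, away from `0` because the symbols are bounded by `|θ|^α` and a constant. -/
lemma exists_norm_errorSymbol_le {α : ℝ} (hα : 1 < α) (hα' : α ≤ 2) :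
    ∃ C : ℝ, 0 ≤ C ∧ ∀ θ : ℝ, ‖errorSymbol α (Complex.I * θ)‖ ≤ C * |θ| ^ (4 + α) := by
  obtain ⟨C₀, hC₀⟩ := (isBigO_compactSymbol_sub_symbolFun (show α ≠ 0 by linarith)).bound
  rw [eventually_nhdsWithin_iff, Metric.eventually_nhds_iff] at hC₀
  obtain ⟨δ, hδ, hnear⟩ := hC₀
  set M : ℝ := ∑' m, ‖kappa₄ α m‖ with hM
  have hM0 : 0 ≤ M := tsum_nonneg fun _ => norm_nonneg _
  set N : ℝ := 1 + ‖varrho α 2‖ * 4 with hN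
  have hN0 : 0 ≤ N := by positivity
  have hexp : ∀ θ : ℝ, ‖Complex.exp (Complex.I * θ)‖ = 1 := fun θ => by simp
  have hexp' : ∀ θ : ℝ, ‖Complex.exp (-(Complex.I * θ))‖ = 1 := fun θ => by
    simpa using norm_exp_I_mul (-θ) 1
  have hC1 : 0 ≤ N / δ ^ (4 : ℝ) := by positivity
  have hC2 : 0 ≤ M / δ ^ (4 + α) := by positivity
  refine ⟨|C₀| + N / δ ^ (4 : ℝ) + M / δ ^ (4 + α), by positivity, fun θ => ?_⟩
  have hp : 0 ≤ |θ| ^ (4 + α) := Real.rpow_nonneg (abs_nonneg _) _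
  have hnorm : ‖Complex.I * (θ : ℂ)‖ = |θ| := by
    rw [norm_mul, Complex.norm_I, one_mul, Complex.norm_real, Real.norm_eq_abs]
  rcases eq_or_ne θ 0 with rfl | hθ
  · have h0 : (α : ℂ) ≠ 0 := by exact_mod_cast (show α ≠ 0 by linarith)
    have hG : G₄ α 1 = 0 := by
      rw [G₄_eq hα hα' (by simp)]
      simp [Complex.zero_cpow h0]
    simp only [errorSymbol, Complex.ofReal_zero, mul_zero, Complex.zero_cpow h0, zero_mul, neg_zero,
      Complex.exp_zero, hG, sub_zero, norm_zero]
    positivity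
  have hθ' : 0 < |θ| := abs_pos.2 hθ
  have hz : Complex.I * (θ : ℂ) ≠ 0 := norm_ne_zero_iff.1 (by rw [hnorm]; exact hθ'.ne')
  have hsplit : |θ| ^ (4 + α) = |θ| ^ α * |θ| ^ 4 := by
    rw [add_comm, Real.rpow_add hθ', ← Real.rpow_natCast _ 4]
    norm_num
  by_cases hlt : |θ| < δ
  · have h1 := hnear (y := Complex.I * (θ : ℂ)) (by rwa [dist_zero_right, hnorm]) hz
    rw [norm_pow, hnorm] at h1
    have hz' : (Complex.I * (θ : ℂ)) ^ (α : ℂ) ≠ 0 := by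
      rw [Complex.cpow_def_of_ne_zero hz]; exact Complex.exp_ne_zero _
    have h2 : errorSymbol α (Complex.I * θ) = (Complex.I * (θ : ℂ)) ^ (α : ℂ) *
        (1 + varrho α 2 * (Complex.exp (Complex.I * θ) - 2 + Complex.exp (-(Complex.I * θ))) -
          symbolFun α (Complex.I * θ)) := by
      rw [errorSymbol, symbolFun_of_ne_zero α hz]
      field_simp
    rw [h2, norm_mul, norm_I_mul_cpow]
    have h3 : |θ| ^ α * (C₀ * |θ| ^ 4) ≤ |C₀| * |θ| ^ (4 + α) := by
      rw [hsplit, mul_left_comm]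
      exact mul_le_mul_of_nonneg_right (le_abs_self _) (by positivity)
    have h4 := (mul_le_mul_of_nonneg_left h1 (Real.rpow_nonneg hθ'.le α)).trans h3
    have h5 : |C₀| * |θ| ^ (4 + α) ≤ (|C₀| + N / δ ^ (4 : ℝ) + M / δ ^ (4 + α)) * |θ| ^ (4 + α) :=
      mul_le_mul_of_nonneg_right (by linarith) hp
    exact h4.trans h5
  · push Not at hlt
    have h1 : ‖(Complex.I * (θ : ℂ)) ^ (α : ℂ) * (1 + varrho α 2 *
        (Complex.exp (Complex.I * θ) - 2 + Complex.exp (-(Complex.I * θ))))‖ ≤ |θ| ^ α * N := by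
      rw [norm_mul, norm_I_mul_cpow]
      refine mul_le_mul_of_nonneg_left ?_ (Real.rpow_nonneg hθ'.le α)
      refine (norm_add_le _ _).trans ?_
      rw [norm_one, norm_mul]
      refine add_le_add le_rfl (mul_le_mul_of_nonneg_left ?_ (norm_nonneg _))
      refine (norm_add_le _ _).trans ?_
      have := norm_sub_le (Complex.exp (Complex.I * θ)) 2
      rw [hexp] at this
      rw [hexp']
      have h2 : ‖(2 : ℂ)‖ = 2 := by simp
      linarith
    have h2 : ‖Complex.exp (Complex.I * θ) * G₄ α (Complex.exp (-(Complex.I * θ)))‖ ≤ M := by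
      rw [norm_mul, hexp, one_mul]
      exact norm_G₄_le hα hα' (hexp' θ).le
    have h3 : |θ| ^ α * N ≤ N / δ ^ (4 : ℝ) * |θ| ^ (4 + α) := by
      rw [hsplit, div_mul_eq_mul_div, le_div_iff₀ (by positivity)]
      have : δ ^ (4 : ℝ) ≤ |θ| ^ 4 := by
        rw [← Real.rpow_natCast _ 4]
        exact Real.rpow_le_rpow hδ.le hlt (by norm_num)
      calc |θ| ^ α * N * δ ^ (4 : ℝ) ≤ |θ| ^ α * N * |θ| ^ 4 :=
            mul_le_mul_of_nonneg_left this (by positivity)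
        _ = N * (|θ| ^ α * |θ| ^ 4) := by ring
    have h4 : M ≤ M / δ ^ (4 + α) * |θ| ^ (4 + α) := by
      rw [div_mul_eq_mul_div, le_div_iff₀ (by positivity)]
      exact mul_le_mul_of_nonneg_left (Real.rpow_le_rpow hδ.le hlt (by linarith)) hM0
    rw [errorSymbol]
    refine (norm_sub_le _ _).trans ((add_le_add (h1.trans h3) (h2.trans h4)).trans ?_)
    rw [← add_mul]
    exact mul_le_mul_of_nonneg_right (by linarith [abs_nonneg C₀]) hp

/-! ### Difference operators as Fourier multipliers -/

lemma norm_exp_phase (ξ y : ℝ) : ‖Complex.exp (-(Complex.I * ((ξ * y : ℝ) : ℂ)))‖ = 1 := by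
  have := norm_exp_I_mul ξ (-y)
  rw [← this]
  congr 2
  push_cast; ring

/-- The compact operator multiplies the density by `1 + ϱ₂ (e^{iξh} - 2 + e^{-iξh})`. -/
lemma compactOp_synth (α : ℝ) {h : ℝ} (hh : h ≠ 0) {w : ℝ → ℂ} (hw : Integrable w) (x : ℝ) :
    compactOp α h (synth w) x = synth (fun ξ => (1 + varrho α 2 *
      (Complex.exp (Complex.I * ((ξ * h : ℝ) : ℂ)) - 2 +
        Complex.exp (-(Complex.I * ((ξ * h : ℝ) : ℂ))))) * w ξ) x := by
  have hh' : (h : ℂ) ≠ 0 := by exact_mod_cast hh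
  have h1 := integrable_mul_exp hw h
  have h2 := integrable_mul_exp hw (-h)
  have h3 : Integrable fun ξ : ℝ =>
      w ξ * Complex.exp (Complex.I * (ξ : ℂ) * ((-h : ℝ) : ℂ)) - 2 * w ξ := h2.sub (hw.const_mul 2)
  have h4 : Integrable fun ξ : ℝ =>
      w ξ * Complex.exp (Complex.I * (ξ : ℂ) * ((-h : ℝ) : ℂ)) - 2 * w ξ +
        w ξ * Complex.exp (Complex.I * (ξ : ℂ) * (h : ℂ)) := h3.add h1
  rw [compactOp, centralDiff, mul_assoc, mul_div_cancel₀ _ (pow_ne_zero 2 hh'), sub_eq_add_neg x h,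
    synth_translate, synth_translate, ← synth_const_mul 2, ← synth_sub h2 (hw.const_mul 2),
    ← synth_add h3 h1, ← synth_const_mul,
    ← synth_add hw (h4.const_mul _)]
  congr 1; ext ξ
  have e1 : Complex.I * (ξ : ℂ) * (h : ℂ) = Complex.I * ((ξ * h : ℝ) : ℂ) := by push_cast; ring
  have e2 : Complex.I * (ξ : ℂ) * ((-h : ℝ) : ℂ) = -(Complex.I * ((ξ * h : ℝ) : ℂ)) := by
    push_cast; ring
  rw [e1, e2]
  ring

lemma MemC.summable_kappa₄ {s : ℝ} (hs : 0 ≤ s) {u : ℝ → ℂ} (hu : MemC s u) {α : ℝ} (hα : 1 < α)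
    (hα' : α ≤ 2) (y : ℕ → ℝ) : Summable (fun m : ℕ => kappa₄ α m * u (y m)) := by
  obtain ⟨B, -, hB⟩ := hu.exists_bound hs
  refine Summable.of_norm_bounded ((summable_norm_kappa₄ hα hα').mul_right B) fun m => ?_
  rw [norm_mul]
  exact mul_le_mul_of_nonneg_left (hB _) (norm_nonneg _)

/-- The shifted difference operator has symbol `h^{-α} e^{iξh} G₄(e^{-iξh})`. -/
lemma MemC.BL_eq_synth {s : ℝ} (hs : 0 ≤ s) {u : ℝ → ℂ} (hu : MemC s u) {α : ℝ} (hα : 1 < α)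
    (hα' : α ≤ 2) (h x : ℝ) :
    BL α h u x = 1 / ((h ^ α : ℝ) : ℂ) * synth (fun ξ =>
      Complex.exp (Complex.I * ((ξ * h : ℝ) : ℂ)) *
        G₄ α (Complex.exp (-(Complex.I * ((ξ * h : ℝ) : ℂ)))) * density u ξ) x := by
  have hv := hu.integrable_density hs
  rw [BL]
  congr 1
  set F : ℕ → ℝ → ℂ := fun m ξ => kappa₄ α m *
    (density u ξ * Complex.exp (Complex.I * (ξ : ℂ) * ((x - ((m : ℝ) - 1) * h : ℝ) : ℂ))) with hF
  have hFi : ∀ m, Integrable (F m) := fun m => (integrable_mul_exp hv _).const_mul _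
  have hFs : Summable fun m => ∫ ξ, ‖F m ξ‖ := by
    have : ∀ m, ∫ ξ, ‖F m ξ‖ = ‖kappa₄ α m‖ * ∫ ξ, ‖density u ξ‖ := by
      intro m
      rw [← integral_const_mul]
      simp only [hF, norm_mul, norm_exp_I_mul, mul_one]
    simp only [this]
    exact (summable_norm_kappa₄ hα hα').mul_right _
  have hsum := (hasSum_integral_of_summable_integral_norm hFi hFs).tsum_eq
  have hterm : ∀ m, ∫ ξ, F m ξ = kappa₄ α m * u (x - ((m : ℝ) - 1) * h) := by
    intro m
    rw [← hu.synth_density hs, synth, ← integral_const_mul]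
  simp only [hterm] at hsum
  rw [hsum, synth]
  congr 1; ext ξ
  have hG := (hasSum_kappa₄ hα hα' (norm_exp_phase ξ h).le).mul_right
    (density u ξ * Complex.exp (Complex.I * ((ξ * h : ℝ) : ℂ)) *
      Complex.exp (Complex.I * (ξ : ℂ) * (x : ℂ)))
  have hG' := hG.tsum_eq
  rw [show Complex.exp (Complex.I * ((ξ * h : ℝ) : ℂ)) *
        G₄ α (Complex.exp (-(Complex.I * ((ξ * h : ℝ) : ℂ)))) * density u ξ *
        Complex.exp (Complex.I * (ξ : ℂ) * (x : ℂ)) =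
      G₄ α (Complex.exp (-(Complex.I * ((ξ * h : ℝ) : ℂ)))) * (density u ξ *
        Complex.exp (Complex.I * ((ξ * h : ℝ) : ℂ)) *
        Complex.exp (Complex.I * (ξ : ℂ) * (x : ℂ))) by ring, ← hG']
  congr 1; ext m
  simp only [hF]
  have e : Complex.exp (Complex.I * (ξ : ℂ) * ((x - ((m : ℝ) - 1) * h : ℝ) : ℂ)) =
      Complex.exp (-(Complex.I * ((ξ * h : ℝ) : ℂ))) ^ m *
        Complex.exp (Complex.I * ((ξ * h : ℝ) : ℂ)) *
        Complex.exp (Complex.I * (ξ : ℂ) * (x : ℂ)) := by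
    rw [← Complex.exp_nat_mul, ← Complex.exp_add, ← Complex.exp_add]
    congr 1
    push_cast; ring
  rw [e]
  ring

/-! ### Consistency on the whole line -/

lemma errorSymbol_scaled {α : ℝ} {h : ℝ} (hh : 0 < h) (ξ : ℝ) (v : ℂ) :
    (1 + varrho α 2 * (Complex.exp (Complex.I * ((ξ * h : ℝ) : ℂ)) - 2 +
        Complex.exp (-(Complex.I * ((ξ * h : ℝ) : ℂ))))) *
        ((Complex.I * (ξ : ℂ)) ^ (α : ℂ) * v) -
      1 / ((h ^ α : ℝ) : ℂ) * (Complex.exp (Complex.I * ((ξ * h : ℝ) : ℂ)) *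
        G₄ α (Complex.exp (-(Complex.I * ((ξ * h : ℝ) : ℂ)))) * v) =
      1 / ((h ^ α : ℝ) : ℂ) * (errorSymbol α (Complex.I * ((ξ * h : ℝ) : ℂ)) * v) := by
  have hp : ((h ^ α : ℝ) : ℂ) ≠ 0 := by exact_mod_cast (Real.rpow_pos_of_pos hh α).ne'
  have h1 : (Complex.I * ((ξ * h : ℝ) : ℂ)) ^ (α : ℂ) =
      ((h ^ α : ℝ) : ℂ) * (Complex.I * (ξ : ℂ)) ^ (α : ℂ) := by
    rw [Complex.ofReal_cpow hh.le, ← ofReal_mul_cpow hh]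
    congr 1
    push_cast; ring
  rw [errorSymbol, h1]
  field_simp

/-- The left-sided compact formula is accurate to order four, for every step size. -/
lemma MemC.exists_left_bound {α : ℝ} (hα : 1 < α) (hα' : α ≤ 2) {u : ℝ → ℂ}
    (hu : MemC (4 + α) u) :
    ∃ C : ℝ, ∀ h : ℝ, 0 < h → ∀ x : ℝ,
      ‖compactOp α h (rlDerivLeft α u) x - BL α h u x‖ ≤ C * h ^ 4 := by
  obtain ⟨C, hC0, hC⟩ := exists_norm_errorSymbol_le hα hα'
  refine ⟨C * ∫ ξ, |ξ| ^ (4 + α) * ‖density u ξ‖, fun h hh x => ?_⟩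
  have hs : 0 ≤ 4 + α := by linarith
  have hw := hu.integrable_cpow_mul_density hs (r := α) (by linarith) (by linarith)
  have hv := hu.integrable_density hs
  have hphase : Continuous fun ξ : ℝ => Complex.exp (Complex.I * ((ξ * h : ℝ) : ℂ)) := by fun_prop
  have hphase' : Continuous fun ξ : ℝ => Complex.exp (-(Complex.I * ((ξ * h : ℝ) : ℂ))) := by
    fun_prop
  have hn1 : ∀ ξ : ℝ, ‖Complex.exp (Complex.I * ((ξ * h : ℝ) : ℂ))‖ = 1 := fun ξ => by
    simpa using norm_exp_I_mul (ξ * h) 1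
  have hi1 : Integrable fun ξ : ℝ => (1 + varrho α 2 *
      (Complex.exp (Complex.I * ((ξ * h : ℝ) : ℂ)) - 2 +
        Complex.exp (-(Complex.I * ((ξ * h : ℝ) : ℂ))))) *
        ((Complex.I * (ξ : ℂ)) ^ (α : ℂ) * density u ξ) := by
    refine hw.bdd_mul (c := 1 + ‖varrho α 2‖ * 4)
      (Continuous.aestronglyMeasurable (by fun_prop)) (Eventually.of_forall fun ξ => ?_)
    refine (norm_add_le _ _).trans ?_
    rw [norm_one, norm_mul]
    refine add_le_add le_rfl (mul_le_mul_of_nonneg_left ?_ (norm_nonneg _))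
    refine (norm_add_le _ _).trans ?_
    have h1 := norm_sub_le (Complex.exp (Complex.I * ((ξ * h : ℝ) : ℂ))) 2
    have h2 : ‖(2 : ℂ)‖ = 2 := by simp
    rw [norm_exp_phase]
    linarith [hn1 ξ]
  have hi2 : Integrable fun ξ : ℝ => Complex.exp (Complex.I * ((ξ * h : ℝ) : ℂ)) *
        G₄ α (Complex.exp (-(Complex.I * ((ξ * h : ℝ) : ℂ)))) * density u ξ := by
    refine hv.bdd_mul (c := ∑' m, ‖kappa₄ α m‖) ?_ (Eventually.of_forall fun ξ => ?_)
    · have hG : Measurable (G₄ α) := by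
        unfold G₄ G₂ genBase
        exact Measurable.mul (by fun_prop) (Measurable.pow_const (by fun_prop) _)
      exact (hphase.measurable.mul (hG.comp hphase'.measurable)).aestronglyMeasurable
    · rw [norm_mul, hn1, one_mul]
      exact norm_G₄_le hα hα' (norm_exp_phase ξ h).le
  rw [hu.rlDerivLeft_eq hα hα' (by linarith), compactOp_synth α hh.ne' hw,
    hu.BL_eq_synth hs hα hα', ← synth_const_mul, ← synth_sub hi1 (hi2.const_mul _)]
  simp only [errorSymbol_scaled hh]
  have hpos := Real.rpow_pos_of_pos hh α
  have hbound := hu.integrable_rpow_mul_density hs (r := 4 + α) (by linarith) le_rfl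
  refine (norm_synth_le _ _).trans ?_
  have hle : ∀ ξ : ℝ, ‖1 / ((h ^ α : ℝ) : ℂ) *
      (errorSymbol α (Complex.I * ((ξ * h : ℝ) : ℂ)) * density u ξ)‖ ≤
      C * h ^ 4 * (|ξ| ^ (4 + α) * ‖density u ξ‖) := by
    intro ξ
    rw [norm_mul, norm_mul, norm_div, norm_one, Complex.norm_real, Real.norm_of_nonneg hpos.le,
      one_div_mul_eq_div, div_le_iff₀ hpos]
    refine (mul_le_mul_of_nonneg_right (hC (ξ * h)) (norm_nonneg _)).trans_eq ?_
    have e : h ^ (4 + α) = h ^ 4 * h ^ α := by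
      rw [Real.rpow_add hh, ← Real.rpow_natCast _ 4]; norm_num
    rw [abs_mul, abs_of_pos hh, Real.mul_rpow (abs_nonneg _) hh.le, e]
    ring
  calc ∫ ξ, ‖1 / ((h ^ α : ℝ) : ℂ) *
      (errorSymbol α (Complex.I * ((ξ * h : ℝ) : ℂ)) * density u ξ)‖
      ≤ ∫ ξ, C * h ^ 4 * (|ξ| ^ (4 + α) * ‖density u ξ‖) :=
        integral_mono_of_nonneg (Eventually.of_forall fun _ => norm_nonneg _)
          (hbound.const_mul _) (Eventually.of_forall hle)
    _ = C * (∫ ξ, |ξ| ^ (4 + α) * ‖density u ξ‖) * h ^ 4 := by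
        rw [integral_const_mul]; ring

lemma compactOp_comp_neg (α h : ℝ) (f : ℝ → ℂ) (x : ℝ) :
    compactOp α h (fun y => f (-y)) x = compactOp α h f (-x) := by
  rw [compactOp, compactOp, centralDiff, centralDiff,
    show -(x - h) = -x + h by ring, show -(x + h) = -x - h by ring]
  ring

lemma BR_eq (α h : ℝ) (u : ℝ → ℂ) (x : ℝ) : BR α h u x = BL α h (fun y => u (-y)) (-x) := by
  rw [BR, BL]
  congr 2; ext m
  congr 2; ring

lemma AR_eq (b α h : ℝ) (u : ℝ → ℂ) (x : ℝ) :
    AR b α h u x = AL (-b) α h (fun y => u (-y)) (-x) := by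
  rw [AR, AL, show -x - -b = b - x by ring]
  congr 1
  refine Finset.sum_congr rfl fun m _ => ?_
  congr 2; ring

lemma MemC.exists_right_bound {α : ℝ} (hα : 1 < α) (hα' : α ≤ 2) {u : ℝ → ℂ}
    (hu : MemC (4 + α) u) :
    ∃ C : ℝ, ∀ h : ℝ, 0 < h → ∀ x : ℝ,
      ‖compactOp α h (rlDerivRight α u) x - BR α h u x‖ ≤ C * h ^ 4 := by
  obtain ⟨C, hC⟩ := hu.comp_neg.exists_left_bound hα hα'
  refine ⟨C, fun h hh x => ?_⟩
  rw [show rlDerivRight α u = fun x => rlDerivLeft α (fun y => u (-y)) (-x) from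
    funext (rlDerivRight_eq α u), compactOp_comp_neg, BR_eq]
  exact hC h hh (-x)

lemma compactOp_const_mul_add (α h : ℝ) (c : ℂ) (f g : ℝ → ℂ) (x : ℝ) :
    compactOp α h (fun y => c * (f y + g y)) x =
      c * (compactOp α h f x + compactOp α h g x) := by
  simp only [compactOp, centralDiff]
  ring

lemma MemC.exists_riesz_bound {α : ℝ} (hα : 1 < α) (hα' : α ≤ 2) {u : ℝ → ℂ}
    (hu : MemC (4 + α) u) :
    ∃ C : ℝ, ∀ h : ℝ, 0 < h → ∀ x : ℝ,
      ‖compactOp α h (rieszDeriv α u) x -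
        (rieszConst α : ℂ) * (BL α h u x + BR α h u x)‖ ≤ C * h ^ 4 := by
  obtain ⟨C₁, h₁⟩ := hu.exists_left_bound hα hα'
  obtain ⟨C₂, h₂⟩ := hu.exists_right_bound hα hα'
  refine ⟨‖(rieszConst α : ℂ)‖ * (C₁ + C₂), fun h hh x => ?_⟩
  have e : compactOp α h (rieszDeriv α u) x - (rieszConst α : ℂ) * (BL α h u x + BR α h u x) =
      (rieszConst α : ℂ) * ((compactOp α h (rlDerivLeft α u) x - BL α h u x) +
        (compactOp α h (rlDerivRight α u) x - BR α h u x)) := by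
    rw [show rieszDeriv α u = fun y => (rieszConst α : ℂ) * (rlDerivLeft α u y + rlDerivRight α u y)
      from rfl, compactOp_const_mul_add]
    ring
  rw [e, norm_mul, mul_assoc, add_mul]
  exact mul_le_mul_of_nonneg_left ((norm_add_le _ _).trans (add_le_add (h₁ h hh x) (h₂ h hh x)))
    (norm_nonneg _)

lemma MemC.exists_laplacian_bound {α : ℝ} (hα : 1 < α) (hα' : α ≤ 2) {u : ℝ → ℂ}
    (hu : MemC (4 + α) u) :
    ∃ C : ℝ, ∀ h : ℝ, 0 < h → ∀ x : ℝ,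
      ‖compactOp α h (fracLaplacian α u) x -
        -((rieszConst α : ℂ) * (BL α h u x + BR α h u x))‖ ≤ C * h ^ 4 := by
  obtain ⟨C, hC⟩ := hu.exists_riesz_bound hα hα'
  refine ⟨C, fun h hh x => ?_⟩
  have e : compactOp α h (fracLaplacian α u) x = -compactOp α h (rieszDeriv α u) x := by
    rw [show fracLaplacian α u = fun y => -rieszDeriv α u y from
      funext (hu.fracLaplacian_eq_neg_rieszDeriv hα hα' (by linarith))]
    simp only [compactOp, centralDiff]
    ring
  rw [e, ← neg_sub', norm_neg]
  exact hC h hh x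

/-! ### Truncated sums for functions supported in an interval -/

/-- The multiplier of the backward difference `f(y) - f(y - t)`. -/
def backwardPhase (t ξ : ℝ) : ℂ := 1 - Complex.exp (-(Complex.I * ((ξ * t : ℝ) : ℂ)))

lemma norm_backwardPhase_le_two (t ξ : ℝ) : ‖backwardPhase t ξ‖ ≤ 2 := by
  refine (norm_sub_le _ _).trans ?_
  rw [norm_exp_phase, norm_one]
  norm_num

lemma norm_backwardPhase_le (t ξ : ℝ) : ‖backwardPhase t ξ‖ ≤ |ξ * t| := by
  have := Real.norm_exp_I_mul_ofReal_sub_one_le (x := -(ξ * t))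
  have e : -(Complex.I * ((ξ * t : ℝ) : ℂ)) = Complex.I * ((-(ξ * t) : ℝ) : ℂ) := by
    push_cast; ring
  rwa [Real.norm_eq_abs, abs_neg, ← e, norm_sub_rev] at this

lemma integrable_backwardPhase_pow {w : ℝ → ℂ} (hw : Integrable w) (t : ℝ) (n : ℕ) :
    Integrable fun ξ => backwardPhase t ξ ^ n * w ξ := by
  refine hw.bdd_mul (c := 2 ^ n) (Continuous.aestronglyMeasurable ?_)
    (Eventually.of_forall fun ξ => ?_)
  · unfold backwardPhase; fun_prop
  · rw [norm_pow]
    exact pow_le_pow_left₀ (norm_nonneg _) (norm_backwardPhase_le_two t ξ) n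

lemma synth_backwardPhase_succ {w : ℝ → ℂ} (hw : Integrable w) (t : ℝ) (n : ℕ) (y : ℝ) :
    synth (fun ξ => backwardPhase t ξ ^ (n + 1) * w ξ) y =
      synth (fun ξ => backwardPhase t ξ ^ n * w ξ) y -
        synth (fun ξ => backwardPhase t ξ ^ n * w ξ) (y - t) := by
  have hi := integrable_backwardPhase_pow hw t n
  rw [sub_eq_add_neg y t, synth_translate _ y (-t), ← synth_sub hi (integrable_mul_exp hi _)]
  congr 1; ext ξ
  have : Complex.I * (ξ : ℂ) * ((-t : ℝ) : ℂ) = -(Complex.I * ((ξ * t : ℝ) : ℂ)) := by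
    push_cast; ring
  rw [this, pow_succ]
  simp only [backwardPhase]
  ring

/-- Within one step `t` to the right of a half-line on which a superposition vanishes, its iterated
backward differences with step `t` coincide with the superposition itself. -/
lemma synth_backwardPhase_eq {w : ℝ → ℂ} (hw : Integrable w) {a t : ℝ} (ht : 0 ≤ t)
    (h0 : ∀ y ≤ a, synth w y = 0) (n : ℕ) :
    (∀ y ≤ a, synth (fun ξ => backwardPhase t ξ ^ n * w ξ) y = 0) ∧
      ∀ y ≤ a + t, synth (fun ξ => backwardPhase t ξ ^ n * w ξ) y = synth w y := by
  induction n with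
  | zero => simpa using h0
  | succ n ih =>
    refine ⟨fun y hy => ?_, fun y hy => ?_⟩
    · rw [synth_backwardPhase_succ hw, ih.1 y hy, ih.1 (y - t) (by linarith), sub_zero]
    · rw [synth_backwardPhase_succ hw, ih.2 y hy, ih.1 (y - t) (by linarith), sub_zero]

/-- A function of the class `𝒞^{4+α}` that vanishes on `(-∞, a]` is `O(t^{4+α})` at `a + t`. -/
lemma MemC.exists_boundary_bound {α : ℝ} (hα : 1 < α) (hα' : α ≤ 2) {u : ℝ → ℂ}
    (hu : MemC (4 + α) u) {a : ℝ} (h0 : ∀ y ≤ a, u y = 0) :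
    ∃ C : ℝ, 0 ≤ C ∧ ∀ t : ℝ, 0 ≤ t → ‖u (a + t)‖ ≤ C * t ^ (4 + α) := by
  have hs : 0 ≤ 4 + α := by linarith
  have hv := hu.integrable_density hs
  have hbound := hu.integrable_rpow_mul_density hs (r := 4 + α) (by linarith) le_rfl
  refine ⟨2 ^ (2 - α) * ∫ ξ, |ξ| ^ (4 + α) * ‖density u ξ‖,
    mul_nonneg (by positivity) (integral_nonneg fun _ => by positivity), fun t ht => ?_⟩
  -- Six differences suffice because the weight `|ξ|^{4+α}` has exponent at most `6`.
  have h := (synth_backwardPhase_eq hv ht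
    (fun y hy => by rw [hu.synth_density hs, h0 y hy]) 6).2 (a + t) le_rfl
  rw [← hu.synth_density hs, ← h]
  refine (norm_synth_le _ _).trans ?_
  have hle : ∀ ξ : ℝ, ‖backwardPhase t ξ ^ 6 * density u ξ‖ ≤
      2 ^ (2 - α) * t ^ (4 + α) * (|ξ| ^ (4 + α) * ‖density u ξ‖) := by
    intro ξ
    have e : ‖backwardPhase t ξ‖ ^ 6 =
        ‖backwardPhase t ξ‖ ^ (2 - α) * ‖backwardPhase t ξ‖ ^ (4 + α) := by
      rw [← Real.rpow_add_of_nonneg (norm_nonneg _) (by linarith) (by linarith),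
        ← Real.rpow_natCast]
      congr 1; push_cast; ring
    rw [norm_mul, norm_pow, e, ← mul_assoc]
    refine mul_le_mul_of_nonneg_right ?_ (norm_nonneg _)
    rw [mul_assoc]
    refine mul_le_mul (Real.rpow_le_rpow (norm_nonneg _) (norm_backwardPhase_le_two t ξ)
      (by linarith)) ?_ (by positivity) (by positivity)
    rw [← Real.mul_rpow ht (abs_nonneg _), mul_comm t, ← abs_of_nonneg ht, ← abs_mul,
      abs_of_nonneg ht]
    exact Real.rpow_le_rpow (norm_nonneg _) (norm_backwardPhase_le t ξ) hs
  calc ∫ ξ, ‖backwardPhase t ξ ^ 6 * density u ξ‖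
      ≤ ∫ ξ, 2 ^ (2 - α) * t ^ (4 + α) * (|ξ| ^ (4 + α) * ‖density u ξ‖) :=
        integral_mono_of_nonneg (Eventually.of_forall fun _ => norm_nonneg _)
          (hbound.const_mul _) (Eventually.of_forall hle)
    _ = 2 ^ (2 - α) * (∫ ξ, |ξ| ^ (4 + α) * ‖density u ξ‖) * t ^ (4 + α) := by
        rw [integral_const_mul]; ring

/-- Stopping the sum at `m = ⌊(x - a) / h⌋` drops exactly one possibly nonzero term, which samples
`u` within distance `h` of the end point `a`, where `u` is `O(h^{4+α})`. -/
lemma MemC.exists_truncation_bound {α : ℝ} (hα : 1 < α) (hα' : α ≤ 2) {u : ℝ → ℂ}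
    (hu : MemC (4 + α) u) {a : ℝ} (h0 : ∀ y ≤ a, u y = 0) :
    ∃ C : ℝ, ∀ h : ℝ, 0 < h → ∀ x : ℝ, a < x → ‖BL α h u x - AL a α h u x‖ ≤ C * h ^ 4 := by
  obtain ⟨C, hC0, hC⟩ := hu.exists_boundary_bound hα hα' h0
  set K : ℝ := ∑' m, ‖kappa₄ α m‖ with hK
  have hK0 : 0 ≤ K := tsum_nonneg fun _ => norm_nonneg _
  refine ⟨K * C, fun h hh x hx => ?_⟩
  set n : ℕ := ⌊(x - a) / h⌋₊ with hn
  have hn1 : (n : ℝ) * h ≤ x - a := by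
    rw [← le_div_iff₀ hh]
    exact Nat.floor_le (div_nonneg (by linarith) hh.le)
  have hn2 : x - a < (n + 1 : ℝ) * h := by
    rw [← div_lt_iff₀ hh]
    exact Nat.lt_floor_add_one _
  -- The offset `m - 1` in the sample point leaves one nonzero term, `m = n + 1`, out of the sum.
  have hzero : ∀ m ∉ Finset.range (n + 1 + 1),
      kappa₄ α m * u (x - ((m : ℝ) - 1) * h) = 0 := by
    intro m hm
    rw [Finset.mem_range, not_lt] at hm
    have hm' : (n : ℝ) + 1 ≤ (m : ℝ) - 1 := by
      have : ((n + 1 + 1 : ℕ) : ℝ) ≤ m := by exact_mod_cast hm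
      push_cast at this
      linarith
    have := mul_le_mul_of_nonneg_right hm' hh.le
    rw [h0 _ (by linarith), mul_zero]
  have hpos := Real.rpow_pos_of_pos hh α
  set t : ℝ := x - a - n * h with ht
  have ht0 : 0 ≤ t := by linarith
  have hth : t ≤ h := by linarith
  have hdiff : BL α h u x - AL a α h u x =
      1 / ((h ^ α : ℝ) : ℂ) * (kappa₄ α (n + 1) * u (a + t)) := by
    rw [BL, AL, tsum_eq_sum hzero, Finset.sum_range_succ, ← mul_sub, add_sub_cancel_left]
    congr 3
    rw [ht]; push_cast; ring
  have hκ : ‖kappa₄ α (n + 1)‖ ≤ K :=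
    (summable_norm_kappa₄ hα hα').le_tsum (n + 1) fun _ _ => norm_nonneg _
  have e : h ^ (4 + α) = h ^ 4 * h ^ α := by
    rw [Real.rpow_add hh, ← Real.rpow_natCast _ 4]; norm_num
  rw [hdiff, norm_mul, norm_mul, norm_div, norm_one, Complex.norm_real,
    Real.norm_of_nonneg hpos.le, one_div_mul_eq_div, div_le_iff₀ hpos]
  calc ‖kappa₄ α (n + 1)‖ * ‖u (a + t)‖ ≤ K * (C * h ^ (4 + α)) := by
        refine mul_le_mul hκ ((hC t ht0).trans ?_) (norm_nonneg _) hK0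
        exact mul_le_mul_of_nonneg_left (Real.rpow_le_rpow ht0 hth (by linarith)) hC0
    _ = K * C * h ^ 4 * h ^ α := by rw [e]; ring

lemma MemC.exists_interval_bound {α : ℝ} (hα : 1 < α) (hα' : α ≤ 2) {u : ℝ → ℂ}
    (hu : MemC (4 + α) u) {a b : ℝ} (h0 : ∀ x : ℝ, x ∉ Set.Ioo a b → u x = 0) :
    ∃ C : ℝ, ∀ h : ℝ, 0 < h → ∀ x ∈ Set.Ioo a b,
      ‖compactOp α h (fracLaplacian α u) x -
        -((rieszConst α : ℂ) * (AL a α h u x + AR b α h u x))‖ ≤ C * h ^ 4 := by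
  obtain ⟨C, hC⟩ := hu.exists_laplacian_bound hα hα'
  obtain ⟨C₁, h₁⟩ := hu.exists_truncation_bound hα hα' (a := a)
    fun y hy => h0 y fun hy' => absurd hy'.1 (not_lt.2 hy)
  obtain ⟨C₂, h₂⟩ := hu.comp_neg.exists_truncation_bound hα hα' (a := -b)
    fun y hy => h0 (-y) fun hy' => absurd hy'.2 (by linarith)
  refine ⟨C + ‖(rieszConst α : ℂ)‖ * (C₁ + C₂), fun h hh x hx => ?_⟩
  have e : compactOp α h (fracLaplacian α u) x -
      -((rieszConst α : ℂ) * (AL a α h u x + AR b α h u x)) =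
      (compactOp α h (fracLaplacian α u) x -
        -((rieszConst α : ℂ) * (BL α h u x + BR α h u x))) -
      (rieszConst α : ℂ) * ((BL α h u x - AL a α h u x) + (BR α h u x - AR b α h u x)) := by
    ring
  have hR : ‖BR α h u x - AR b α h u x‖ ≤ C₂ * h ^ 4 := by
    rw [BR_eq, AR_eq]
    exact h₂ h hh (-x) (by linarith [hx.2])
  rw [e, add_mul]
  refine (norm_sub_le _ _).trans (add_le_add (hC h hh x) ?_)
  rw [norm_mul, mul_assoc, add_mul]
  exact mul_le_mul_of_nonneg_left
    ((norm_add_le _ _).trans (add_le_add (h₁ h hh x hx.1) hR)) (norm_nonneg _)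

lemma uniformO4_of_bound {S : Set ℝ} {E : ℝ → ℝ → ℂ}
    (h : ∃ C : ℝ, ∀ h : ℝ, 0 < h → ∀ x ∈ S, ‖E h x‖ ≤ C * h ^ 4) : UniformO4 S E := by
  obtain ⟨C, hC⟩ := h
  refine ⟨C, ?_⟩
  filter_upwards [self_mem_nhdsWithin] with h hh
  exact hC h hh

end FracCompact

end

theorem theorem3p5 (α : ℝ) (hα : 1 < α) (hα' : α ≤ 2) (u : ℝ → ℂ)
    (hu : FracCompact.MemC (4 + α) u) :
    -- the value of the coefficient `ϱ₂`
    FracCompact.varrho α 2 =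
      (((3 * α ^ 3 - 19 * α ^ 2 + 36 * α - 16) / (24 * α) : ℝ) : ℂ) ∧
    -- all the objects in the formulas below are well defined
    FracCompact.RLLeftExists α u ∧
    FracCompact.RLRightExists α u ∧
    FracCompact.FracLaplacianExists α u ∧
    (∀ h : ℝ, 0 < h → ∀ x : ℝ,
      Summable (fun m : ℕ => FracCompact.kappa₄ α m * u (x - ((m : ℝ) - 1) * h)) ∧
      Summable (fun m : ℕ => FracCompact.kappa₄ α m * u (x + ((m : ℝ) - 1) * h))) ∧
    -- left Riemann–Liouville derivative
    FracCompact.UniformO4 Set.univ (fun h x =>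
      FracCompact.compactOp α h (FracCompact.rlDerivLeft α u) x - FracCompact.BL α h u x) ∧
    -- right Riemann–Liouville derivative
    FracCompact.UniformO4 Set.univ (fun h x =>
      FracCompact.compactOp α h (FracCompact.rlDerivRight α u) x - FracCompact.BR α h u x) ∧
    -- Riesz derivative
    FracCompact.UniformO4 Set.univ (fun h x =>
      FracCompact.compactOp α h (FracCompact.rieszDeriv α u) x -
        (FracCompact.rieszConst α : ℂ) * (FracCompact.BL α h u x + FracCompact.BR α h u x)) ∧
    -- fractional Laplacian on the line
    FracCompact.UniformO4 Set.univ (fun h x =>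
      FracCompact.compactOp α h (FracCompact.fracLaplacian α u) x -
        -((FracCompact.rieszConst α : ℂ) * (FracCompact.BL α h u x + FracCompact.BR α h u x))) ∧
    -- fractional Laplacian on a bounded interval, for `u` extended by zero
    (∀ a b : ℝ, a < b → (∀ x : ℝ, x ∉ Set.Ioo a b → u x = 0) →
      FracCompact.UniformO4 (Set.Ioo a b) (fun h x =>
        FracCompact.compactOp α h (FracCompact.fracLaplacian α u) x -
          -((FracCompact.rieszConst α : ℂ) *
            (FracCompact.AL a α h u x + FracCompact.AR b α h u x)))) := by
  have hs : 0 ≤ 4 + α := by linarith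
  have hαs : α ≤ 4 + α := by linarith
  refine ⟨FracCompact.varrho_two (by linarith), hu.rlLeftExists hα hα' hαs,
    (hu.comp_neg.rlLeftExists hα hα' hαs).right_of_reflection, hu.fracLaplacianExists hα hαs,
    fun h _ x => ⟨hu.summable_kappa₄ hs hα hα' _, hu.summable_kappa₄ hs hα hα' _⟩, ?_, ?_, ?_, ?_,
    fun a b _ h0 => ?_⟩ <;> apply FracCompact.uniformO4_of_bound
  · simpa using hu.exists_left_bound hα hα'
  · simpa using hu.exists_right_bound hα hα'
  · simpa using hu.exists_riesz_bound hα hα'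
  · simpa using hu.exists_laplacian_bound hα hα'
  · exact hu.exists_interval_bound hα hα' h0
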